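/- Let $K$ be a field of characteristic $0$, $D$ a set, and $H_R=H_R(D)$ the commutative Hopf algebra over $K$ of rooted trees with nodes decorated by $D$: it is the polynomial algebra on the (non-planar) trees, and its coproduct is the algebra morphism with $\Delta\circ B_+^d=B_+^d\otimes 1+(\mathrm{id}\otimes B_+^d)\circ\Delta$, where $B_+^d$ grafts a forest onto a new root decorated by $d\in D$. For linear operators $L_d$ $(d\in D)$ on a commutative algebra $A$ let $\rho_{L}:H_R\to A$ be the unique algebra morphism with $\rho_L\circ B_+^d=L_d\circ\rho_L$. For a functional $\alpha$ on $H_R$ put $\delta\alpha=(\mathrm{id}\otimes\alpha)\circ\Delta-\alpha(\cdot)1$. A one-cocycle is a linear map $L$ on $H_R$ with $\Delta\circ L=(\mathrm{id}\otimes L)\circ\Delta+L\otimes 1$. For each $d\in D$ let $F_d(z)=\sum_{n\ge-1}c^{(d)}_n z^n\in K((z))$ be a Mellin transform with $c^{(d)}_{-1}=-1$. The regularized Feynman rules are $\phi=\rho_{L}:H_R\to K((z))[S]$ with $L_d(S^n)=F_d((n+1)z)S^{n+1}$ ($L_d$ linear over $K((z))$), where $S=s^{-z}$; let $\phi_a$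 be their value at $\log s=a\in K$, that is at $S=\exp(-az)$. The rules renormalized by subtraction at $\log\mu=b$ are $\phi_{a,b}=\phi_b^{\star-1}\star\phi_a$ ($\star$ is convolution). A linear map $\varphi:H_R\to K[x]$ is the physical limit if, for all $a,b\in K$ and $h\in H_R$, $\phi_{a,b}(h)\in K[[z]]$ and its value at $z=0$ is $\varphi(h)(a-b)$. Let $\int_0:K[x]\to K[x]$, $x^n\mapsto x^{n+1}/(n+1)$, and let $\varphi_0:H_R\to K[x]$ be the leading-log rules, $\varphi_0\circ B_+^d=\int_0\circ\,\varphi_0$ for all $d$. Let $\eta_{(d)}(x^n)=n!\,(-1)^n c_n^{(d)}$ and let $\chi:H_R\to H_R$ be the algebra morphism with $\chi\circ B_+^d=\bigl(B_+^d+\delta(\eta_{(d)}\circ\varphi_0)\bigr)\circ\chi$. Let $\kappa\in K$ and, for $n\ge1$, let $B_n=\sum_{d}a_{n,d}B_+^d$ be a finite linear combination of grafting operators (for instance $B_n=B_+^n$ with $D=\mathbb N$, or multiples of a single $B_+$), and $\eta_n=\sum_d a_{n,d}\,\eta_{(d)}$. For a power series $Y$ with constant term $1$ and $p\in K$ put $Y^p=\sum_{i\ge0}\binom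 pi(Y-1)^i$. Then the physical limit $\varphi$ exists and is unique; for the original Mellin transform $F_d(z)=-1/z$ $(d\in D)$ the leading-log rules $\varphi_0$ are a physical limit; and the Dyson–Schwinger equation $$X(g)=1+\sum_{n\ge1}g^nB_n\bigl(X(g)^{1+n\kappa}\bigr)$$ has a unique solution $X(g)\in H_R[[g]]$. Put $\widetilde X(g)=\chi\circ X(g)$ (maps are applied to the coefficients of power series in $g$). Then: 1. $\varphi\circ X=\varphi_0\circ\widetilde X$ in $K[x][[g]]$. 2. For $n\ge1$ the operators $B_n$ and $B_n+\delta(\eta_n\circ\varphi_0)$ are one-cocycles, and $$\widetilde X(g)=1+\sum_{n\ge1}g^n\bigl(B_n+\delta(\eta_n\circ\varphi_0)\bigr)\bigl(\widetilde X(g)^{1+n\kappa}\bigr).$$ 3. The leading logs coincide: for every forest $w$ with $|w|$ nodes, $\varphi(w)-\varphi_0(w)$ has degree less than $|w|$. The coefficient $x_n$ of $g^n$ in $X$ lies in the span of the forests with at most $n$ nodes, and whenever it lies in the span of the forests with at most $m$ nodes, $\varphi(x_n)$ and $\varphi_0(x_n)$ have degree at most $m$ and the same coefficient of $x^m$. 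-/

import Mathlib

open scoped TensorProduct Nat

namespace DSE

universe u v w

/-! ### Decorated rooted trees -/

/-- Finite planar rooted trees with nodes decorated by `D`: a root together with the list of the
subtrees attached to it. -/
inductive PlanarTree (D : Type u) : Type u
  | node : D → List (PlanarTree D) → PlanarTree D

namespace PlanarTree

variable {D : Type u}

/-- Isomorphism of rooted trees: the smallest equivalence relation that forgets the order of the
subtrees at every node. -/
inductive Iso : PlanarTree D → PlanarTree D → Prop
  | refl (t : PlanarTree D) : Iso t t
  | symm {t t' : PlanarTree D} : Iso t t' → Iso t' t
  | trans {t t' t'' : PlanarTree D} : Iso t t' → Iso t' t'' → Iso t t''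
  | perm (d : D) {l l' : List (PlanarTree D)} : l.Perm l' → Iso (node d l) (node d l')
  | child (d : D) (l₁ l₂ : List (PlanarTree D)) {t t' : PlanarTree D} :
      Iso t t' → Iso (node d (l₁ ++ t :: l₂)) (node d (l₁ ++ t' :: l₂))

/-- Recursion along the subtrees, insensitive to their order. -/
def fold {α : Type v} (f : D → Multiset α → α) : PlanarTree D → α
  | node d l => f d (Multiset.ofList (l.map (fold f)))

theorem fold_iso {α : Type v} (f : D → Multiset α → α) {t t' : PlanarTree D} (h : Iso t t') :
    fold f t = fold f t' := by
  induction h with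
  | refl t => rfl
  | symm _ ih => exact ih.symm
  | trans _ _ ih ih' => exact ih.trans ih'
  | perm d h =>
    rw [fold, fold]
    exact congrArg (f d) (Multiset.coe_eq_coe.2 (h.map _))
  | child d l₁ l₂ _ ih =>
    rw [fold, fold, List.map_append, List.map_append, List.map_cons, List.map_cons, ih]

instance isoSetoid (D : Type u) : Setoid (PlanarTree D) :=
  ⟨Iso, Iso.refl, Iso.symm, Iso.trans⟩

end PlanarTree

/-- Finite (unordered, non-planar) rooted trees with nodes decorated by `D`, up to isomorphism. -/
def Tree (D : Type u) : Type u := Quotient (PlanarTree.isoSetoid D)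

/-- Rooted forests: multisets of rooted trees. -/
abbrev Forest (D : Type u) : Type u := Multiset (Tree D)

namespace Tree

variable {D : Type u}

/-- The unordered tree underlying a planar tree. -/
def mk (t : PlanarTree D) : Tree D := Quotient.mk _ t

/-- A planar representative of a tree. -/
noncomputable def out (t : Tree D) : PlanarTree D := Quotient.out t

theorem mk_out (t : Tree D) : mk (out t) = t := Quotient.out_eq t

/-- The tree whose root is decorated by `d` and carries the trees of the forest `w`. -/
noncomputable def node (d : D) (w : Forest D) : Tree D :=
  mk (PlanarTree.node d (w.map out).toList)

/-- Recursion over rooted trees. -/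
def fold {α : Type v} (f : D → Multiset α → α) (t : Tree D) : α :=
  Quotient.lift (PlanarTree.fold f) (fun _ _ h => PlanarTree.fold_iso f h) t

theorem fold_node {α : Type v} (f : D → Multiset α → α) (d : D) (w : Forest D) :
    fold f (node d w) = f d (w.map (fold f)) := by
  have h : ∀ t : Tree D, PlanarTree.fold f (out t) = fold f t := by
    intro t
    conv_rhs => rw [← mk_out t]
    rfl
  change PlanarTree.fold f (PlanarTree.node d _) = _
  rw [PlanarTree.fold, ← Multiset.map_coe, Multiset.coe_toList, Multiset.map_map]
  exact congrArg (f d) (Multiset.map_congr rfl (fun t _ => h t))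

theorem node_congr_aux (d : D) (l₀ l l' : List (PlanarTree D))
    (h : List.Forall₂ PlanarTree.Iso l l') :
    PlanarTree.Iso (PlanarTree.node d (l₀ ++ l)) (PlanarTree.node d (l₀ ++ l')) := by
  induction h generalizing l₀ with
  | nil => exact PlanarTree.Iso.refl _
  | @cons a b l l' hab _ ih =>
    refine PlanarTree.Iso.trans (PlanarTree.Iso.child d l₀ l hab) ?_
    have := ih (l₀ ++ [b])
    simpa using this

theorem mk_node (d : D) (l : List (PlanarTree D)) :
    mk (PlanarTree.node d l) = node d (Multiset.ofList (l.map mk)) := by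
  refine Quotient.sound (PlanarTree.Iso.trans (t' := PlanarTree.node d
    (l.map (fun t => out (mk t)))) ?_ (PlanarTree.Iso.perm d ?_))
  · refine node_congr_aux d [] _ _ ?_
    rw [List.forall₂_map_right_iff]
    exact List.forall₂_same.2 (fun t _ => PlanarTree.Iso.symm (Quotient.mk_out t))
  · rw [← Multiset.coe_eq_coe, Multiset.coe_toList, Multiset.map_coe, List.map_map]
    rfl

theorem induction {p : Tree D → Prop} (h : ∀ (d : D) (w : Forest D), (∀ t ∈ w, p t) → p (node d w))
    (t : Tree D) : p t := by
  have key : ∀ t : PlanarTree D, p (mk t) := by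
    intro t
    induction t using PlanarTree.rec (motive_2 := fun l => ∀ t ∈ l, p (mk t)) with
    | node d l ih =>
      rw [mk_node]
      refine h d _ ?_
      intro t ht
      rw [Multiset.mem_coe, List.mem_map] at ht
      obtain ⟨s, hs, rfl⟩ := ht
      exact ih s hs
    | nil => rename_i t ht; simp at ht
    | cons a l iha ihl =>
      rename_i t ht
      rcases List.mem_cons.1 ht with rfl | ht
      · exact iha
      · exact ihl t ht
  induction t using Quotient.ind with
  | _ t => exact key t

/-- The number of nodes. -/
def size (t : Tree D) : ℕ := fold (fun _ m => 1 + m.sum) t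

end Tree

/-- The number of nodes of a forest. -/
def Forest.size {D : Type u} (w : Forest D) : ℕ := (w.map Tree.size).sum

/-! ### The Hopf algebra of decorated rooted trees -/

section HR

variable (K : Type v) [Field K] (D : Type u)

/-- The free commutative algebra on the rooted trees. -/
abbrev HR : Type (max u v) := MvPolynomial (Tree D) K

variable {D}

/-- A forest, as the product of its trees. -/
noncomputable def forest (w : Forest D) : HR K D :=
  (w.map (fun t => (MvPolynomial.X t : HR K D))).prod

/-- The span of the forests with at most `m` nodes. -/
noncomputable def HRle (m : ℕ) : Submodule K (HR K D) :=
  Submodule.span K {h | ∃ w : Forest D, w.size ≤ m ∧ h = forest K w}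

/-- The grafting operator: it joins the trees of a forest to a new root decorated by `d`. -/
noncomputable def graft (d : D) : HR K D →ₗ[K] HR K D :=
  (MvPolynomial.basisMonomials (Tree D) K).constr K
    (fun s => MvPolynomial.X (Tree.node d (Finsupp.toMultiset s)))

variable {K}

/-- The universal morphism `ρ_L`, characterized by `ρ_L ∘ graft d = L d ∘ ρ_L`. -/
noncomputable def univ {A : Type w} [CommRing A] [Algebra K A] (L : D → A →ₗ[K] A) :
    HR K D →ₐ[K] A :=
  MvPolynomial.aeval (Tree.fold (fun d (m : Multiset A) => L d m.prod))

theorem monomial_eq_forest (s : Tree D →₀ ℕ) :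
    MvPolynomial.monomial s (1 : K) = forest K (Finsupp.toMultiset s) := by
  rw [forest, MvPolynomial.monomial_eq, MvPolynomial.C_1, one_mul, Finsupp.toMultiset_map,
    Finsupp.prod_toMultiset, Finsupp.prod_mapDomain_index (by simp) (by intros; rw [pow_add])]

theorem graft_forest (d : D) (w : Forest D) :
    graft K d (forest K w) = MvPolynomial.X (Tree.node d w) := by
  classical
  obtain ⟨s, rfl⟩ : ∃ s : Tree D →₀ ℕ, Finsupp.toMultiset s = w :=
    ⟨Multiset.toFinsupp w, Multiset.toFinsupp_toMultiset w⟩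
  rw [← monomial_eq_forest, graft]
  exact (MvPolynomial.basisMonomials (Tree D) K).constr_basis K _ s

theorem forest_induction {p : HR K D → Prop} (hf : ∀ w, p (forest K w))
    (hadd : ∀ x y, p x → p y → p (x + y)) (hsmul : ∀ (c : K) x, p x → p (c • x))
    (x : HR K D) : p x := by
  induction x using MvPolynomial.induction_on' with
  | monomial s c =>
    have := hsmul c _ (hf (Finsupp.toMultiset s))
    rwa [← monomial_eq_forest, MvPolynomial.smul_monomial, smul_eq_mul, mul_one] at this
  | add x y hx hy => exact hadd x y hx hy

theorem univ_graft {A : Type w} [CommRing A] [Algebra K A] (L : D → A →ₗ[K] A) (d : D)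
    (x : HR K D) : univ L (graft K d x) = L d (univ L x) := by
  induction x using forest_induction with
  | hf w =>
    rw [graft_forest, univ, MvPolynomial.aeval_X, Tree.fold_node, forest,
      map_multiset_prod (MvPolynomial.aeval _), Multiset.map_map]
    simp only [Function.comp_def, MvPolynomial.aeval_X]
  | hadd x y hx hy => simp only [map_add, hx, hy]
  | hsmul c x hx => simp only [map_smul, hx]

theorem algHom_ext_graft {A : Type w} [CommRing A] [Algebra K A] {f g : HR K D →ₐ[K] A}
    (h : ∀ d x, f x = g x → f (graft K d x) = g (graft K d x)) : f = g := by
  refine MvPolynomial.algHom_ext (fun t => ?_)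
  induction t using Tree.induction with
  | h d w ih =>
    rw [← graft_forest]
    refine h d _ ?_
    rw [forest, map_multiset_prod, map_multiset_prod, Multiset.map_map, Multiset.map_map]
    exact congrArg _ (Multiset.map_congr rfl ih)

variable (K D)

/-- The counit: it vanishes on every tree. -/
noncomputable def counit : HR K D →ₐ[K] K := MvPolynomial.aeval (fun _ => 0)

/-- Auxiliary: `x ↦ (x, Δ x)`. -/
noncomputable def comulPair : HR K D →ₐ[K] HR K D × (HR K D ⊗[K] HR K D) :=
  univ (fun d => LinearMap.prod
    (graft K d ∘ₗ LinearMap.fst K _ _)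
    ((TensorProduct.mk K (HR K D) (HR K D)).flip 1 ∘ₗ graft K d ∘ₗ LinearMap.fst K _ _
      + (graft K d).lTensor (HR K D) ∘ₗ LinearMap.snd K _ _))

/-- The coproduct `Δ`: the morphism of algebras such that
`Δ (graft d x) = graft d x ⊗ 1 + (id ⊗ graft d) (Δ x)`. -/
noncomputable def comul : HR K D →ₐ[K] HR K D ⊗[K] HR K D :=
  (AlgHom.snd K _ _).comp (comulPair K D)

theorem comulPair_fst : (AlgHom.fst K _ _).comp (comulPair K D) = AlgHom.id K (HR K D) := by
  refine algHom_ext_graft (fun d x h => ?_)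
  rw [AlgHom.comp_apply, AlgHom.id_apply] at h
  rw [AlgHom.comp_apply, AlgHom.id_apply, comulPair, univ_graft, ← comulPair]
  exact congrArg (graft K d) h

theorem comul_graft (d : D) (x : HR K D) :
    comul K D (graft K d x)
      = graft K d x ⊗ₜ[K] 1 + (graft K d).lTensor (HR K D) (comul K D x) := by
  have h : (comulPair K D x).1 = x := DFunLike.congr_fun (comulPair_fst K D) x
  rw [comul, AlgHom.comp_apply, comulPair, univ_graft, ← comulPair]
  change graft K d (comulPair K D x).1 ⊗ₜ[K] 1
    + (graft K d).lTensor (HR K D) (comulPair K D x).2 = _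
  rw [h]
  rfl

variable {K D}

/-- The convolution product `m ∘ (f ⊗ g) ∘ Δ`. -/
noncomputable def conv {A : Type w} [CommRing A] [Algebra K A] (f g : HR K D →ₗ[K] A) :
    HR K D →ₗ[K] A :=
  LinearMap.mul' K A ∘ₗ TensorProduct.map f g ∘ₗ (comul K D).toLinearMap

variable (K D)

/-- Auxiliary: the morphism of algebras `(S ⊗ id) ∘ Δ`, where `S` is the antipode. -/
noncomputable def antipodeAux : HR K D →ₐ[K] HR K D ⊗[K] HR K D :=
  univ (fun d => (graft K d).lTensor (HR K D)
    - (TensorProduct.mk K (HR K D) (HR K D)).flip 1 ∘ₗ LinearMap.mul' K (HR K D) ∘ₗ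
        (graft K d).lTensor (HR K D))

/-- The antipode. -/
noncomputable def antipode : HR K D →ₐ[K] HR K D :=
  (Algebra.TensorProduct.rid K K (HR K D)).toAlgHom.comp
    ((Algebra.TensorProduct.map (AlgHom.id K (HR K D)) (counit K D)).comp (antipodeAux K D))

theorem counit_graft (d : D) (x : HR K D) : counit K D (graft K d x) = 0 := by
  induction x using forest_induction with
  | hf w => rw [graft_forest, counit, MvPolynomial.aeval_X]
  | hadd x y hx hy => simp only [map_add, hx, hy, add_zero]
  | hsmul c x hx => simp only [map_smul, hx, smul_zero]

theorem antipode_graft (d : D) (x : HR K D) :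
    antipode K D (graft K d x)
      = - LinearMap.mul' K (HR K D) ((graft K d).lTensor (HR K D) (antipodeAux K D x)) := by
  have h : ∀ y : HR K D ⊗[K] HR K D,
      Algebra.TensorProduct.map (AlgHom.id K (HR K D)) (counit K D)
        ((graft K d).lTensor (HR K D) y) = 0 := by
    intro y
    induction y with
    | zero => simp
    | add a b ha hb => rw [map_add, map_add, ha, hb, add_zero]
    | tmul a b => simp [counit_graft]
  rw [antipode, AlgHom.comp_apply, AlgHom.comp_apply, antipodeAux, univ_graft, ← antipodeAux,
    LinearMap.sub_apply, map_sub, h]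
  simp

theorem antipodeAux_eq :
    antipodeAux K D
      = (Algebra.TensorProduct.map (antipode K D) (AlgHom.id K (HR K D))).comp (comul K D) := by
  refine algHom_ext_graft (fun d x hx => ?_)
  have h : ∀ y : HR K D ⊗[K] HR K D,
      Algebra.TensorProduct.map (antipode K D) (AlgHom.id K (HR K D))
        ((graft K d).lTensor (HR K D) y)
      = (graft K d).lTensor (HR K D)
          (Algebra.TensorProduct.map (antipode K D) (AlgHom.id K (HR K D)) y) := by
    intro y
    induction y with
    | zero => simp
    | add a b ha hb => simp only [map_add, ha, hb]
    | tmul a b => simp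
  rw [AlgHom.comp_apply] at hx
  rw [AlgHom.comp_apply, comul_graft, map_add, h, ← hx, Algebra.TensorProduct.map_tmul,
    antipode_graft, antipodeAux, univ_graft, ← antipodeAux]
  simp [TensorProduct.neg_tmul, sub_eq_neg_add]

/-- The defining property `S ⋆ id = u ∘ ε` of the antipode. -/
theorem antipode_conv_id :
    conv (antipode K D).toLinearMap LinearMap.id
      = Algebra.linearMap K (HR K D) ∘ₗ (counit K D).toLinearMap := by
  have h : (Algebra.TensorProduct.lmul' K).comp (antipodeAux K D)
      = (Algebra.ofId K (HR K D)).comp (counit K D) := by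
    refine algHom_ext_graft (fun d x _ => ?_)
    rw [AlgHom.comp_apply, AlgHom.comp_apply, counit_graft, map_zero, antipodeAux, univ_graft,
      LinearMap.sub_apply, map_sub, sub_eq_zero]
    simp only [LinearMap.comp_apply, LinearMap.flip_apply, TensorProduct.mk_apply,
      Algebra.TensorProduct.lmul'_apply_tmul, mul_one]
    rfl
  refine LinearMap.ext (fun x => ?_)
  have hx := DFunLike.congr_fun h x
  rw [antipodeAux_eq] at hx
  exact hx

variable {K D}

/-- Hochschild one-cocycles: `Δ ∘ L = (id ⊗ L) ∘ Δ + L ⊗ 1`. -/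
def IsOneCocycle (L : HR K D →ₗ[K] HR K D) : Prop :=
  ∀ x, comul K D (L x) = L.lTensor (HR K D) (comul K D x) + L x ⊗ₜ[K] 1

/-- The coboundary `δα = (id ⊗ α) ∘ Δ - u ∘ α` of a functional `α`. -/
noncomputable def coboundary (α : HR K D →ₗ[K] K) : HR K D →ₗ[K] HR K D :=
  (TensorProduct.rid K (HR K D)).toLinearMap ∘ₗ α.lTensor (HR K D) ∘ₗ (comul K D).toLinearMap
    - Algebra.linearMap K (HR K D) ∘ₗ α

end HR

/-! ### Dyson-Schwinger equations -/

section Equations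

variable {K : Type v} [Field K]

/-- The generalized binomial coefficient `p (p - 1) ⋯ (p - n + 1) / n!`. -/
noncomputable def gbinom (p : K) (n : ℕ) : K := (descPochhammer K n).eval p / (n ! : K)

/-- The power `X ^ p = ∑ n, (p choose n) (X - 1) ^ n` of a power series with constant
coefficient `1`; since `(X - 1) ^ n` has order at least `n`, only the terms with `n ≤ k`
contribute to the coefficient of order `k`. -/
noncomputable def seriesPow {A : Type w} [CommRing A] [Algebra K A] (X : PowerSeries A) (p : K) :
    PowerSeries A :=
  PowerSeries.mk fun k => ∑ n ∈ Finset.range (k + 1),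
    gbinom p n • PowerSeries.coeff k ((X - 1) ^ n)

/-- A linear map applied to the coefficients of a power series. -/
noncomputable def mapCoeff {A : Type u} {B : Type w} [CommRing A] [Algebra K A] [CommRing B]
    [Algebra K B] (f : A →ₗ[K] B) (X : PowerSeries A) : PowerSeries B :=
  PowerSeries.mk fun n => f (PowerSeries.coeff n X)

/-- The Dyson-Schwinger equation `X = 1 + ∑_{n ≥ 1} g ^ n B_n (X ^ (1 + n κ))` in the power
series in `g` over the Hopf algebra of rooted trees. -/
def SolvesDSE {D : Type u} (κ : K) (B : ℕ → HR K D →ₗ[K] HR K D) (X : PowerSeries (HR K D)) :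
    Prop :=
  X = 1 + PowerSeries.mk fun k => ∑ n ∈ Finset.Icc 1 k,
    B n (PowerSeries.coeff (k - n) (seriesPow X (1 + (n : K) * κ)))

end Equations

/-! ### Feynman rules -/

section Rules

variable {K : Type v} [Field K]

/-- The coefficientwise algebra structure on Laurent series (Mathlib's own, given priority over a
propositionally equal one that passes through power series). -/
noncomputable instance (priority := 2000) laurentAlgebra : Algebra K (LaurentSeries K) :=
  HahnSeries.instAlgebra

/-- The integration operator `x ^ n ↦ x ^ (n + 1) / (n + 1)` on polynomials. -/
noncomputable def polyInt : Polynomial K →ₗ[K] Polynomial K :=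
  Polynomial.lsum fun n => ((n : K) + 1)⁻¹ • Polynomial.monomial (n + 1)

variable (K) in
/-- The leading-log Feynman rules, `ρ` of the integration operator. -/
noncomputable def leadingLogRules (D : Type u) : HR K D →ₐ[K] Polynomial K :=
  univ fun _ => polyInt

/-- The functional `η (x ^ n) = n! (-1) ^ n c_n` given by the coefficients of `F = ∑ c_n z ^ n`. -/
noncomputable def eta (F : LaurentSeries K) : Polynomial K →ₗ[K] K :=
  Polynomial.lsum fun n => ((n ! : K) * (-1) ^ n * F.coeff (n : ℤ)) • LinearMap.id

/-- The Laurent series `F (m z)`. -/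
noncomputable def dilate (m : K) (F : LaurentSeries K) : LaurentSeries K where
  coeff n := m ^ n * F.coeff n
  isPWO_support' := F.isPWO_support.mono (fun n hn h => hn (by
    change m ^ n * F.coeff n = 0
    rw [h, mul_zero]))

/-- The integral operator `g ↦ ∫ f(ζ) (sζ)^(-z) g(sζ) dζ` on polynomials in `S = s ^ (-z)` with
coefficients in the Laurent series in the regulator `z`, written through the Mellin transform
`F(z) = ∫ f(ζ) ζ^(-z) dζ`: it sends `S ^ n` to `F((n + 1) z) S ^ (n + 1)`. -/
noncomputable def mellinOp (F : LaurentSeries K) :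
    Polynomial (LaurentSeries K) →ₗ[K] Polynomial (LaurentSeries K) :=
  Polynomial.lsum fun n =>
    (Polynomial.monomial (R := LaurentSeries K) (n + 1)).restrictScalars K ∘ₗ
      LinearMap.mulLeft K (dilate ((n : K) + 1) F)

/-- The regularized, unrenormalized Feynman rules with Mellin transforms `F d`, as functions of
`S = s ^ (-z)`. -/
noncomputable def regRules {D : Type u} (F : D → LaurentSeries K) :
    HR K D →ₐ[K] Polynomial (LaurentSeries K) :=
  univ fun d => mellinOp (F d)

variable [CharZero K]

/-- The regularized Feynman rules at the scale `s` with `log s = a`, that is at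
`s ^ (-z) = exp (-a z)`. -/
noncomputable def regRulesAt {D : Type u} (F : D → LaurentSeries K) (a : K) :
    HR K D →ₐ[K] LaurentSeries K :=
  ((Polynomial.aeval (HahnSeries.ofPowerSeries ℤ K
    (PowerSeries.rescale (-a) (PowerSeries.exp K)))).restrictScalars K).comp (regRules F)

/-- The Feynman rules at `log s = a`, renormalized by subtraction at the scale `μ` with
`log μ = b` (kinetic scheme): the convolution of the inverse of the rules at `μ` with the rules
at `s`. -/
noncomputable def renRules {D : Type u} (F : D → LaurentSeries K) (a b : K) :
    HR K D →ₗ[K] LaurentSeries K :=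
  conv ((regRulesAt F b).comp (antipode K D)).toLinearMap (regRulesAt F a).toLinearMap

/-- `Φ` is the physical limit of the renormalized Feynman rules: for all scales, the renormalized
rules have no poles in `z`, and their value at `z = 0` is the polynomial `Φ h` evaluated
at `ℓ = log (s / μ)`. -/
def IsPhysicalLimit {D : Type u} (F : D → LaurentSeries K) (Φ : HR K D →ₗ[K] Polynomial K) :
    Prop :=
  ∀ (a b : K) (h : HR K D), (∀ n : ℤ, n < 0 → (renRules F a b h).coeff n = 0) ∧
    (renRules F a b h).coeff 0 = (Φ h).eval (a - b)

/-- The functionals `η_d ∘ ρ` on rooted trees, where `ρ` are the leading-log rules. -/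
noncomputable def etaTree {D : Type u} (F : D → LaurentSeries K) (d : D) : HR K D →ₗ[K] K :=
  eta (F d) ∘ₗ (leadingLogRules K D).toLinearMap

/-- The automorphism `χ` with `χ ∘ graft d = (graft d + δ(η_d ∘ ρ)) ∘ χ`. -/
noncomputable def mellinAuto {D : Type u} (F : D → LaurentSeries K) : HR K D →ₐ[K] HR K D :=
  univ fun d => graft K d + coboundary (etaTree F d)

end Rules

end DSE

/-! Everything reduces to one algebra morphism `physicalRules`, the universal morphism for the
operators `∫₀ + δη_d` on polynomials. Two independent facts meet there.

Algebraic side: `∫₀` is a one-cocycle on `K[x]` with `x` primitive, so the leading-log rules respect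
coproducts (`polyComul_leadingLogRules`) and carry `δ(η ∘ φ₀)` to `δη`. Hence `φ₀ ∘ χ` satisfies the
recursion defining `physicalRules` (`leadingLogRules_comp_mellinAuto`).

Analytic side: after subtraction, grafting acts on polynomials in `S` as the Mellin operator minus
its value at `S = exp(-bz)`. Put `S = exp(-(x+b)z)`. Since `exp(-mxz)` is group-like and
`η(exp(-mxz))` is the regular part of `F(mz)`, while `∫₀ exp(-mxz) = -(exp(-mxz) - 1)/(mz)` accounts
for the pole, `(∫₀ + δη) exp(-mxz) = F(mz)(exp(-mxz) - 1)` (`laurentOp_expXZ`). So each grafting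
becomes multiplication by `S` followed by `∫₀ + δη_d` on the coefficients in `z`. This preserves
power series, so no pole ever appears; at `z = 0` one has `S = 1`, and `physicalRules` remains.

The Dyson–Schwinger equation is a contraction in the order in `g`, and an algebra morphism commutes
with the powers in it, so `χ` transports solutions. Finally `δη` does not raise degrees while `∫₀`
raises them by one, so only `∫₀` reaches the leading coefficient. -/

namespace DSE

universe u v w

/-! ### Coassociativity, one-cocycles and coboundaries on rooted trees -/

section HopfAlgebra

variable {K : Type v} [Field K] {D : Type u}

/-- The variant for plain ring morphisms serves the later comparison with the exponential
substitution, which is only given as a ring morphism. -/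
theorem ringHom_ext_graft {A : Type w} [CommRing A] {f g : HR K D →+* A}
    (hC : ∀ c : K, f (MvPolynomial.C c) = g (MvPolynomial.C c))
    (h : ∀ d x, f x = g x → f (graft K d x) = g (graft K d x)) : f = g := by
  refine MvPolynomial.ringHom_ext hC (fun t => ?_)
  induction t using Tree.induction with
  | h d w ih =>
    rw [← graft_forest]
    refine h d _ ?_
    rw [forest, map_multiset_prod, map_multiset_prod, Multiset.map_map, Multiset.map_map]
    exact congrArg _ (Multiset.map_congr rfl ih)

theorem univ_unique {A : Type w} [CommRing A] [Algebra K A] {L : D → A →ₗ[K] A}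
    {f : HR K D →ₐ[K] A} (h : ∀ d x, f (graft K d x) = L d (f x)) : f = univ L :=
  algHom_ext_graft (fun d x hx => by rw [h, univ_graft, hx])

/-- Both sides are algebra morphisms, so it suffices to pass through one grafting. There the cocycle
identity gives both the same new terms besides `id ⊗ id ⊗ B₊` applied to the induction hypothesis.
-/
theorem comul_coassoc :
    (Algebra.TensorProduct.map (AlgHom.id K (HR K D)) (comul K D)).comp (comul K D)
      = ((Algebra.TensorProduct.assoc K K K (HR K D) (HR K D) (HR K D)).toAlgHom.comp
          (Algebra.TensorProduct.map (comul K D) (AlgHom.id K (HR K D)))).comp (comul K D) := by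
  refine algHom_ext_graft (A := HR K D ⊗[K] (HR K D ⊗[K] HR K D)) (fun d x hx => ?_)
  have h₁ : ∀ y : HR K D ⊗[K] HR K D,
      Algebra.TensorProduct.map (AlgHom.id K (HR K D)) (comul K D)
        ((graft K d).lTensor (HR K D) y)
      = (TensorProduct.assoc K (HR K D) (HR K D) (HR K D))
          ((graft K d).lTensor (HR K D) y ⊗ₜ[K] 1)
        + ((graft K d).lTensor (HR K D)).lTensor (HR K D)
          (Algebra.TensorProduct.map (AlgHom.id K (HR K D)) (comul K D) y) := by
    intro y
    induction y with
    | zero => simp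
    | add a b ha hb =>
      simp only [map_add, ha, hb, TensorProduct.add_tmul]
      abel
    | tmul a b => simp [comul_graft, TensorProduct.tmul_add]
  have h₂ : ∀ y : HR K D ⊗[K] HR K D,
      Algebra.TensorProduct.assoc K K K (HR K D) (HR K D) (HR K D)
        (Algebra.TensorProduct.map (comul K D) (AlgHom.id K (HR K D))
          ((graft K d).lTensor (HR K D) y))
      = ((graft K d).lTensor (HR K D)).lTensor (HR K D)
          (Algebra.TensorProduct.assoc K K K (HR K D) (HR K D) (HR K D)
            (Algebra.TensorProduct.map (comul K D) (AlgHom.id K (HR K D)) y)) := by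
    intro y
    induction y with
    | zero => simp
    | add a b ha hb => simp only [map_add, ha, hb]
    | tmul a b =>
      simp only [LinearMap.lTensor_tmul, Algebra.TensorProduct.map_tmul, AlgHom.id_apply]
      induction comul K D a with
      | zero => simp
      | add a b ha hb => simp only [map_add, TensorProduct.add_tmul, ha, hb]
      | tmul a b => simp
  rw [AlgHom.comp_apply, AlgHom.comp_apply, AlgHom.comp_apply, AlgEquiv.toAlgHom_apply] at hx ⊢
  rw [comul_graft, map_add, map_add, map_add, h₁, h₂, hx, ← add_assoc]
  congr 1
  rw [Algebra.TensorProduct.map_tmul, Algebra.TensorProduct.map_tmul, comul_graft]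
  simp only [AlgHom.id_apply, map_one, TensorProduct.add_tmul, Algebra.TensorProduct.one_def,
    map_add]
  rfl

theorem isOneCocycle_graft (d : D) : IsOneCocycle (graft K d) := fun x => by
  rw [comul_graft, add_comm]

theorem IsOneCocycle.add {L M : HR K D →ₗ[K] HR K D} (hL : IsOneCocycle L)
    (hM : IsOneCocycle M) : IsOneCocycle (L + M) := fun x => by
  simp only [LinearMap.add_apply, map_add, hL x, hM x, LinearMap.lTensor_add,
    TensorProduct.add_tmul]
  abel

theorem IsOneCocycle.smul {L : HR K D →ₗ[K] HR K D} (c : K) (hL : IsOneCocycle L) :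
    IsOneCocycle (c • L) := fun x => by
  simp only [LinearMap.smul_apply, map_smul, hL x, LinearMap.lTensor_smul, smul_add,
    TensorProduct.smul_tmul']

theorem isOneCocycle_zero : IsOneCocycle (0 : HR K D →ₗ[K] HR K D) := fun x => by simp

theorem IsOneCocycle.sum {ι : Type*} (s : Finset ι) {L : ι → HR K D →ₗ[K] HR K D}
    (h : ∀ i ∈ s, IsOneCocycle (L i)) : IsOneCocycle (∑ i ∈ s, L i) := by
  classical
  induction s using Finset.induction_on with
  | empty => exact isOneCocycle_zero
  | insert i s hi ih =>
    rw [Finset.sum_insert hi]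
    exact (h i (Finset.mem_insert_self i s)).add
      (ih (fun j hj => h j (Finset.mem_insert_of_mem hj)))

theorem coboundary_apply (α : HR K D →ₗ[K] K) (x : HR K D) :
    coboundary α x = TensorProduct.rid K (HR K D) (α.lTensor (HR K D) (comul K D x))
      - algebraMap K (HR K D) (α x) := rfl

/-- This is `δ² = 0`: coassociativity identifies `Δ ∘ (id ⊗ α) ∘ Δ` with `(id ⊗ id ⊗ α)` of the
iterated coproduct, and the subtracted constants cancel against `L x ⊗ 1`. -/
theorem isOneCocycle_coboundary (α : HR K D →ₗ[K] K) : IsOneCocycle (coboundary α) := by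
  intro x
  have h := DFunLike.congr_fun (comul_coassoc (K := K) (D := D)) x
  rw [AlgHom.comp_apply, AlgHom.comp_apply, AlgHom.comp_apply, AlgEquiv.toAlgHom_apply] at h
  have h₁ : ∀ y : HR K D ⊗[K] HR K D,
      (coboundary α).lTensor (HR K D) y
        = (TensorProduct.rid K (HR K D)).toLinearMap.lTensor (HR K D)
            ((α.lTensor (HR K D)).lTensor (HR K D)
              (Algebra.TensorProduct.map (AlgHom.id K (HR K D)) (comul K D) y))
          - TensorProduct.rid K (HR K D) (α.lTensor (HR K D) y) ⊗ₜ[K] 1 := by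
    intro y
    induction y with
    | zero => simp
    | add a b ha hb =>
      simp only [map_add, ha, hb, TensorProduct.add_tmul]
      abel
    | tmul a b =>
      rw [LinearMap.lTensor_tmul, coboundary_apply, Algebra.algebraMap_eq_smul_one,
        TensorProduct.tmul_sub, TensorProduct.tmul_smul]
      simp [TensorProduct.smul_tmul']
  have h₂ : ∀ y : HR K D ⊗[K] HR K D,
      comul K D (TensorProduct.rid K (HR K D) (α.lTensor (HR K D) y))
        = (TensorProduct.rid K (HR K D)).toLinearMap.lTensor (HR K D)
            ((α.lTensor (HR K D)).lTensor (HR K D)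
              (Algebra.TensorProduct.assoc K K K (HR K D) (HR K D) (HR K D)
                (Algebra.TensorProduct.map (comul K D) (AlgHom.id K (HR K D)) y))) := by
    intro y
    induction y with
    | zero => simp
    | add a b ha hb => simp only [map_add, ha, hb]
    | tmul a b =>
      simp only [LinearMap.lTensor_tmul, Algebra.TensorProduct.map_tmul, AlgHom.id_apply,
        TensorProduct.rid_tmul, map_smul]
      induction comul K D a with
      | zero => simp
      | add a b ha hb => simp only [map_add, TensorProduct.add_tmul, smul_add, ha, hb]
      | tmul a b => simp
  rw [h₁, h, ← h₂, coboundary_apply, map_sub, TensorProduct.sub_tmul, AlgHom.commutes]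
  simp only [Algebra.TensorProduct.algebraMap_apply]
  abel

theorem coboundary_add (α β : HR K D →ₗ[K] K) :
    coboundary (α + β) = coboundary α + coboundary β := by
  refine LinearMap.ext (fun x => ?_)
  simp only [coboundary_apply, LinearMap.add_apply, LinearMap.lTensor_add, map_add]
  abel

theorem coboundary_smul (c : K) (α : HR K D →ₗ[K] K) :
    coboundary (c • α) = c • coboundary α := by
  refine LinearMap.ext (fun x => ?_)
  simp only [coboundary_apply, LinearMap.smul_apply, LinearMap.lTensor_smul, map_smul, smul_sub,
    smul_eq_mul, Algebra.algebraMap_eq_smul_one, mul_smul]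

/-- The coboundary operator, as a linear map. -/
noncomputable def coboundaryHom : (HR K D →ₗ[K] K) →ₗ[K] HR K D →ₗ[K] HR K D where
  toFun := coboundary
  map_add' := coboundary_add
  map_smul' := coboundary_smul

end HopfAlgebra

/-! ### Polynomials with `x` primitive: integration and coboundaries in divided powers -/

section Polynomials

open Polynomial

variable {K : Type v} [Field K]

variable (K) in
/-- The divided power `x ^ n / n!`. -/
noncomputable def dpow (n : ℕ) : K[X] := monomial n (n ! : K)⁻¹

theorem natDegree_dpow_le (n : ℕ) : (dpow K n).natDegree ≤ n := natDegree_monomial_le _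

theorem dpow_zero : dpow K 0 = 1 := by simp [dpow]

/-- Two polynomials of degree at most `n` with the same coefficient of `x ^ n`. -/
def SameLeading (n : ℕ) (p q : K[X]) : Prop :=
  p.natDegree ≤ n ∧ q.natDegree ≤ n ∧ p.coeff n = q.coeff n

theorem SameLeading.mul {m n : ℕ} {p q p' q' : K[X]} (h : SameLeading m p q)
    (h' : SameLeading n p' q') : SameLeading (m + n) (p * p') (q * q') :=
  ⟨natDegree_mul_le_of_le h.1 h'.1, natDegree_mul_le_of_le h.2.1 h'.2.1, by
    rw [coeff_mul_add_eq_of_natDegree_le h.1 h'.1, coeff_mul_add_eq_of_natDegree_le h.2.1 h'.2.1,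
      h.2.2, h'.2.2]⟩

theorem SameLeading.degree_sub_lt {n : ℕ} {p q : K[X]} (h : SameLeading n p q) :
    (p - q).degree < n := by
  rw [degree_lt_iff_coeff_zero]
  intro m hm
  rw [coeff_sub]
  rcases hm.eq_or_lt with rfl | hm
  · rw [h.2.2, sub_self]
  · rw [coeff_eq_zero_of_natDegree_lt (h.1.trans_lt hm),
      coeff_eq_zero_of_natDegree_lt (h.2.1.trans_lt hm), sub_self]

variable (K) in
/-- The coproduct of the polynomial Hopf algebra, with `x` primitive. -/
noncomputable def polyComul : K[X] →ₐ[K] K[X] ⊗[K] K[X] :=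
  aeval (X ⊗ₜ[K] 1 + 1 ⊗ₜ[K] X)

/-- The coboundary `(id ⊗ α) ∘ Δ - α` of a functional on polynomials. -/
noncomputable def polyCoboundary (α : K[X] →ₗ[K] K) : K[X] →ₗ[K] K[X] :=
  (TensorProduct.rid K K[X]).toLinearMap ∘ₗ α.lTensor K[X] ∘ₗ (polyComul K).toLinearMap
    - Algebra.linearMap K K[X] ∘ₗ α

theorem polyCoboundary_apply (α : K[X] →ₗ[K] K) (p : K[X]) :
    polyCoboundary α p = TensorProduct.rid K K[X] (α.lTensor K[X] (polyComul K p)) - C (α p) := rfl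

variable [CharZero K]

theorem monomial_eq_smul_dpow (n : ℕ) (c : K) : monomial n c = (c * (n ! : K)) • dpow K n := by
  have : (n ! : K) ≠ 0 := Nat.cast_ne_zero.2 (Nat.factorial_ne_zero n)
  rw [dpow, smul_monomial, smul_eq_mul, mul_assoc, mul_inv_cancel₀ this, mul_one]

theorem linearMap_ext_dpow {M : Type w} [AddCommMonoid M] [Module K M] {f g : K[X] →ₗ[K] M}
    (h : ∀ n, f (dpow K n) = g (dpow K n)) : f = g := by
  refine Polynomial.lhom_ext' (fun n => LinearMap.ext (fun c => ?_))
  rw [LinearMap.comp_apply, LinearMap.comp_apply, monomial_eq_smul_dpow, map_smul, map_smul, h]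

theorem natDegree_linearMap_le {T : K[X] →ₗ[K] K[X]} {k : ℕ}
    (hT : ∀ n, (T (dpow K n)).natDegree ≤ n + k) {p : K[X]} {N : ℕ} (hp : p.natDegree ≤ N) :
    (T p).natDegree ≤ N + k := by
  rw [p.as_sum_range' (N + 1) (Nat.lt_succ_of_le hp), map_sum]
  refine natDegree_sum_le_of_forall_le _ _ (fun i hi => ?_)
  rw [monomial_eq_smul_dpow, map_smul]
  exact (natDegree_smul_le _ _).trans ((hT i).trans (by have := Finset.mem_range.1 hi; omega))

theorem polyInt_dpow (n : ℕ) : polyInt (dpow K n) = dpow K (n + 1) := by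
  have h : ((n : K) + 1) ≠ 0 := Nat.cast_add_one_ne_zero n
  simp only [polyInt, dpow, lsum_apply]
  rw [sum_monomial_index _ _ (by simp), LinearMap.smul_apply, smul_monomial, Nat.factorial_succ]
  push_cast
  rw [smul_eq_mul, mul_inv]

theorem coeff_polyInt_succ (p : K[X]) (n : ℕ) :
    (polyInt p).coeff (n + 1) = ((n : K) + 1)⁻¹ * p.coeff n := by
  have h : lcoeff K (n + 1) ∘ₗ polyInt = ((n : K) + 1)⁻¹ • lcoeff K n := by
    refine linearMap_ext_dpow (fun m => ?_)
    rw [LinearMap.comp_apply, LinearMap.smul_apply, polyInt_dpow, lcoeff_apply, lcoeff_apply, dpow,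
      dpow, coeff_monomial, coeff_monomial]
    by_cases hm : m = n
    · subst hm
      rw [if_pos rfl, if_pos rfl, Nat.factorial_succ]
      push_cast
      rw [smul_eq_mul, mul_inv]
    · simp [hm]
  exact LinearMap.congr_fun h p

theorem natDegree_polyInt_le {p : K[X]} {N : ℕ} (hp : p.natDegree ≤ N) :
    (polyInt p).natDegree ≤ N + 1 :=
  natDegree_linearMap_le (fun n => by rw [polyInt_dpow]; exact natDegree_dpow_le _) hp

theorem eta_dpow (F : LaurentSeries K) (n : ℕ) :
    eta F (dpow K n) = (-1) ^ n * F.coeff (n : ℤ) := by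
  have h : (n ! : K) ≠ 0 := Nat.cast_ne_zero.2 (Nat.factorial_ne_zero n)
  simp only [eta, dpow, lsum_apply]
  rw [sum_monomial_index _ _ (by simp), LinearMap.smul_apply, LinearMap.id_apply, smul_eq_mul]
  field_simp

/-- The binomial theorem; the factorials in the divided powers absorb the binomial coefficients. -/
theorem polyComul_dpow (n : ℕ) :
    polyComul K (dpow K n)
      = ∑ ij ∈ Finset.HasAntidiagonal.antidiagonal n, dpow K ij.1 ⊗ₜ[K] dpow K ij.2 := by
  have key : ∀ m, dpow K m = (m ! : K)⁻¹ • X ^ m := fun m => smul_X_eq_monomial.symm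
  rw [key, map_smul, map_pow, polyComul, aeval_X, (Commute.all _ _).add_pow', Finset.smul_sum]
  refine Finset.sum_congr rfl (fun ij hij => ?_)
  obtain ⟨i, j⟩ := ij
  obtain rfl := Finset.HasAntidiagonal.mem_antidiagonal.1 hij
  have h : ((i + j).choose i : K) * (i ! : K) * (j ! : K) = ((i + j)! : K) := by
    rw [Nat.choose_symm_add]
    exact_mod_cast Nat.add_choose_mul_factorial_mul_factorial i j
  have hi : (i ! : K) ≠ 0 := Nat.cast_ne_zero.2 (Nat.factorial_ne_zero i)
  have hj : (j ! : K) ≠ 0 := Nat.cast_ne_zero.2 (Nat.factorial_ne_zero j)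
  have hc : ((i + j).choose i : K) ≠ 0 :=
    Nat.cast_ne_zero.2 (Nat.choose_pos (Nat.le_add_right i j)).ne'
  simp only [key, Algebra.TensorProduct.tmul_pow, one_pow, Algebra.TensorProduct.tmul_mul_tmul,
    mul_one, one_mul, ← h, ← Nat.cast_smul_eq_nsmul K, TensorProduct.tmul_smul,
    ← TensorProduct.smul_tmul', smul_smul]
  congr 1
  field_simp

theorem polyCoboundary_dpow (α : K[X] →ₗ[K] K) (n : ℕ) :
    polyCoboundary α (dpow K n)
      = ∑ ij ∈ Finset.HasAntidiagonal.antidiagonal n, α (dpow K ij.2) • dpow K ij.1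
        - C (α (dpow K n)) := by
  rw [polyCoboundary_apply, polyComul_dpow, map_sum, map_sum]
  simp only [LinearMap.lTensor_tmul, TensorProduct.rid_tmul]

/-- A coboundary only splits off factors and evaluates them. Not raising the degree is what keeps it
away from the leading logarithm. -/
theorem natDegree_polyCoboundary_le (α : K[X] →ₗ[K] K) {p : K[X]} {N : ℕ}
    (hp : p.natDegree ≤ N) : (polyCoboundary α p).natDegree ≤ N := by
  refine natDegree_linearMap_le (k := 0) (fun n => ?_) hp
  rw [polyCoboundary_dpow]
  refine (natDegree_sub_le_of_le (natDegree_sum_le_of_forall_le (n := n) _ _ (fun ij hij => ?_))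
    (natDegree_C _).le).trans (by simp)
  have := Finset.HasAntidiagonal.mem_antidiagonal.1 hij
  exact (natDegree_smul_le _ _).trans ((natDegree_dpow_le _).trans (by omega))

/-- Integration shifts divided powers by one. In the coproduct of the shifted power, the summand
with trivial right factor is split off, and the others are shifts of their right factors. -/
theorem polyComul_polyInt (p : K[X]) :
    polyComul K (polyInt p) = polyInt p ⊗ₜ[K] 1 + polyInt.lTensor K[X] (polyComul K p) := by
  have h : (polyComul K).toLinearMap ∘ₗ polyInt
      = (TensorProduct.mk K K[X] K[X]).flip 1 ∘ₗ polyInt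
        + polyInt.lTensor K[X] ∘ₗ (polyComul K).toLinearMap := by
    refine linearMap_ext_dpow (fun n => ?_)
    simp only [LinearMap.comp_apply, LinearMap.add_apply, AlgHom.toLinearMap_apply,
      LinearMap.flip_apply, TensorProduct.mk_apply, polyInt_dpow, polyComul_dpow, map_sum,
      LinearMap.lTensor_tmul]
    rw [Finset.Nat.sum_antidiagonal_succ', dpow_zero]
  exact LinearMap.congr_fun h p

end Polynomials

/-! ### Leading-log rules, the automorphism, and leading coefficients -/

section LeadingLog

open Polynomial

variable {K : Type v} [Field K] {D : Type u}

theorem leadingLogRules_graft (d : D) (x : HR K D) :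
    leadingLogRules K D (graft K d x) = polyInt (leadingLogRules K D x) := univ_graft _ d x

/-- The algebra morphism intertwining grafting with the integration operator modified by the
coboundary of `η`. -/
noncomputable def physicalRules (F : D → LaurentSeries K) : HR K D →ₐ[K] K[X] :=
  univ fun d => polyInt + polyCoboundary (eta (F d))

theorem physicalRules_graft (F : D → LaurentSeries K) (d : D) (x : HR K D) :
    physicalRules F (graft K d x) = polyInt (physicalRules F x)
      + polyCoboundary (eta (F d)) (physicalRules F x) := univ_graft _ d x

theorem mellinAuto_graft (F : D → LaurentSeries K) (d : D) (x : HR K D) :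
    mellinAuto F (graft K d x) = graft K d (mellinAuto F x)
      + coboundary (etaTree F d) (mellinAuto F x) := univ_graft _ d x

theorem Tree.size_node (d : D) (w : Forest D) : (Tree.node d w).size = w.size + 1 := by
  rw [Tree.size, Tree.fold_node, add_comm]
  rfl

/-- The multiplicative half of the induction, kept conditional on the individual trees so that the
induction on trees can call it on the branches of a root. -/
theorem sameLeading_forest_aux (F : D → LaurentSeries K) (w : Forest D)
    (h : ∀ t ∈ w, SameLeading t.size (physicalRules F (MvPolynomial.X t))
      (leadingLogRules K D (MvPolynomial.X t))) :
    SameLeading w.size (physicalRules F (forest K w)) (leadingLogRules K D (forest K w)) := by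
  induction w using Multiset.induction_on with
  | empty => simp [forest, Forest.size, SameLeading]
  | cons t w ih =>
    have h₁ := (h t (Multiset.mem_cons_self t w)).mul
      (ih (fun s hs => h s (Multiset.mem_cons_of_mem hs)))
    rw [← map_mul, ← map_mul] at h₁
    simpa [forest, Forest.size] using h₁

variable [CharZero K]

variable (K D) in
-- Both grafting and `∫₀` are one-cocycles, so the two algebra morphisms obey the same recursion
-- under grafting.
theorem polyComul_leadingLogRules :
    (polyComul K).comp (leadingLogRules K D)
      = (Algebra.TensorProduct.map (leadingLogRules K D) (leadingLogRules K D)).comp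
          (comul K D) := by
  refine algHom_ext_graft (A := K[X] ⊗[K] K[X]) (fun d x hx => ?_)
  have h : ∀ y : HR K D ⊗[K] HR K D,
      Algebra.TensorProduct.map (leadingLogRules K D) (leadingLogRules K D)
        ((graft K d).lTensor (HR K D) y)
      = polyInt.lTensor K[X]
          (Algebra.TensorProduct.map (leadingLogRules K D) (leadingLogRules K D) y) := by
    intro y
    induction y with
    | zero => simp
    | add a b ha hb => simp only [map_add, ha, hb]
    | tmul a b => simp [leadingLogRules_graft]
  rw [AlgHom.comp_apply, AlgHom.comp_apply] at hx ⊢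
  rw [leadingLogRules_graft, polyComul_polyInt, comul_graft, map_add, h, hx,
    Algebra.TensorProduct.map_tmul, map_one, leadingLogRules_graft]

/-- A morphism compatible with coproducts intertwines the coboundary of a pulled-back functional
with that of the functional itself. -/
theorem leadingLogRules_coboundary (α : K[X] →ₗ[K] K) (x : HR K D) :
    leadingLogRules K D (coboundary (α ∘ₗ (leadingLogRules K D).toLinearMap) x)
      = polyCoboundary α (leadingLogRules K D x) := by
  have h := DFunLike.congr_fun (polyComul_leadingLogRules K D) x
  rw [AlgHom.comp_apply, AlgHom.comp_apply] at h
  rw [coboundary_apply, polyCoboundary_apply, h, map_sub, AlgHom.commutes]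
  congr 1
  induction comul K D x with
  | zero => simp
  | add a b ha hb => simp only [map_add, ha, hb]
  | tmul a b => simp

theorem leadingLogRules_comp_mellinAuto (F : D → LaurentSeries K) :
    (leadingLogRules K D).comp (mellinAuto F) = physicalRules F := by
  refine univ_unique (fun d x => ?_)
  rw [AlgHom.comp_apply, mellinAuto_graft, map_add, leadingLogRules_graft, etaTree,
    leadingLogRules_coboundary]
  rfl

theorem sameLeading_tree (F : D → LaurentSeries K) (t : Tree D) :
    SameLeading t.size (physicalRules F (MvPolynomial.X t))
      (leadingLogRules K D (MvPolynomial.X t)) := by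
  induction t using Tree.induction with
  | h d w ih =>
    obtain ⟨h₁, h₂, h₃⟩ := sameLeading_forest_aux F w ih
    rw [← graft_forest, physicalRules_graft, leadingLogRules_graft, Tree.size_node]
    refine ⟨natDegree_add_le_of_degree_le (natDegree_polyInt_le h₁)
      ((natDegree_polyCoboundary_le _ h₁).trans (Nat.le_succ _)), natDegree_polyInt_le h₂, ?_⟩
    -- The new root raises the node count by one, which the coboundary term cannot follow, so only
    -- the integral contributes to this coefficient.
    rw [coeff_add, coeff_polyInt_succ, coeff_polyInt_succ, h₃, coeff_eq_zero_of_natDegree_lt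
      (Nat.lt_succ_of_le (natDegree_polyCoboundary_le _ h₁)), add_zero]

theorem sameLeading_forest (F : D → LaurentSeries K) (w : Forest D) :
    SameLeading w.size (physicalRules F (forest K w)) (leadingLogRules K D (forest K w)) :=
  sameLeading_forest_aux F w (fun t _ => sameLeading_tree F t)

theorem sameLeading_of_mem_HRle (F : D → LaurentSeries K) {m : ℕ} {x : HR K D}
    (hx : x ∈ HRle K m) : SameLeading m (physicalRules F x) (leadingLogRules K D x) := by
  induction hx using Submodule.span_induction with
  | mem x hx =>
    obtain ⟨w, hw, rfl⟩ := hx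
    have h := sameLeading_forest F w
    refine ⟨h.1.trans hw, h.2.1.trans hw, ?_⟩
    -- Forests with fewer than `m` nodes contribute zero to the coefficient of `x ^ m` on both
    -- sides.
    rcases hw.eq_or_lt with rfl | hw
    · exact h.2.2
    · rw [coeff_eq_zero_of_natDegree_lt (h.1.trans_lt hw),
        coeff_eq_zero_of_natDegree_lt (h.2.1.trans_lt hw)]
  | zero => simp [SameLeading]
  | add x y _ _ hx hy =>
    rw [map_add, map_add]
    exact ⟨natDegree_add_le_of_degree_le hx.1 hy.1, natDegree_add_le_of_degree_le hx.2.1 hy.2.1,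
      by rw [coeff_add, coeff_add, hx.2.2, hy.2.2]⟩
  | smul c x _ hx =>
    rw [map_smul, map_smul]
    exact ⟨(natDegree_smul_le _ _).trans hx.1, (natDegree_smul_le _ _).trans hx.2.1,
      by rw [coeff_smul, coeff_smul, hx.2.2]⟩

end LeadingLog

/-! ### Fixed points of contractions in the adic topology of power series -/

section Contraction

variable {A : Type w} [CommRing A]

theorem coeff_eq_of_X_pow_dvd_sub {X Y : PowerSeries A} {k j : ℕ}
    (h : PowerSeries.X ^ k ∣ X - Y) (hj : j < k) :
    PowerSeries.coeff j X = PowerSeries.coeff j Y := by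
  have := PowerSeries.X_pow_dvd_iff.1 h j hj
  rwa [map_sub, sub_eq_zero] at this

theorem eq_of_forall_X_pow_dvd_sub {X Y : PowerSeries A}
    (h : ∀ k, PowerSeries.X ^ k ∣ X - Y) : X = Y :=
  PowerSeries.ext (fun j => coeff_eq_of_X_pow_dvd_sub (h (j + 1)) (Nat.lt_succ_self j))

/-- A map on power series that improves the order of agreement has a unique fixed point. -/
theorem existsUnique_fixedPoint_powerSeries {T : PowerSeries A → PowerSeries A}
    (hT : ∀ k X Y, PowerSeries.X ^ k ∣ X - Y → PowerSeries.X ^ (k + 1) ∣ T X - T Y) :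
    ∃! X, X = T X := by
  have hstep : ∀ n, PowerSeries.X ^ n ∣ T^[n + 1] 0 - T^[n] 0 := by
    intro n
    induction n with
    | zero => simp
    | succ n ih =>
      rw [Function.iterate_succ_apply' T (n + 1)]
      nth_rw 2 [Function.iterate_succ_apply' T n]
      exact hT n _ _ ih
  have hle : ∀ n m, n ≤ m → PowerSeries.X ^ n ∣ T^[m] 0 - T^[n] 0 := by
    intro n m h
    induction m, h using Nat.le_induction with
    | base => simp
    | succ m hm ih =>
      have := ((pow_dvd_pow _ hm).trans (hstep m)).add ih
      rwa [sub_add_sub_cancel] at this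
  -- The iterates form a Cauchy sequence: from the `(k + 1)`-st on, the coefficient of order `k` is
  -- stable, so this diagonal series is their limit.
  refine ⟨PowerSeries.mk fun k => PowerSeries.coeff k (T^[k + 1] 0), ?_, ?_⟩
  · set Z : PowerSeries A := PowerSeries.mk fun k => PowerSeries.coeff k (T^[k + 1] 0) with hZ
    have hlim : ∀ n, PowerSeries.X ^ n ∣ Z - T^[n] 0 := by
      intro n
      rw [PowerSeries.X_pow_dvd_iff]
      intro j hj
      rw [map_sub, sub_eq_zero, hZ, PowerSeries.coeff_mk]
      exact (coeff_eq_of_X_pow_dvd_sub (hle (j + 1) n hj) (Nat.lt_succ_self j)).symm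
    refine eq_of_forall_X_pow_dvd_sub (fun k => ?_)
    have h₁ := hT k _ _ (hlim k)
    rw [← Function.iterate_succ_apply' T k] at h₁
    have := (hlim (k + 1)).sub h₁
    rw [sub_sub_sub_cancel_right] at this
    exact (pow_dvd_pow _ (Nat.le_succ k)).trans this
  · intro Y hY
    have hlim : ∀ n, PowerSeries.X ^ n ∣ Y - T^[n] 0 := by
      intro n
      induction n with
      | zero => simp
      | succ n ih =>
        rw [Function.iterate_succ_apply', hY]
        exact hT n _ _ ih
    refine PowerSeries.ext (fun j => ?_)
    rw [PowerSeries.coeff_mk]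
    exact coeff_eq_of_X_pow_dvd_sub (hlim (j + 1)) (Nat.lt_succ_self j)

end Contraction

/-! ### Existence, uniqueness and transport of Dyson–Schwinger solutions -/

section Equations

variable {K : Type v} [Field K] {D : Type u}

theorem coeff_seriesPow {A : Type w} [CommRing A] [Algebra K A] (X : PowerSeries A) (p : K)
    (k : ℕ) : PowerSeries.coeff k (seriesPow X p)
      = ∑ n ∈ Finset.range (k + 1), gbinom p n • PowerSeries.coeff k ((X - 1) ^ n) :=
  PowerSeries.coeff_mk _ _

theorem coeff_seriesPow_congr {A : Type w} [CommRing A] [Algebra K A] {X Y : PowerSeries A}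
    {k j : ℕ} (h : PowerSeries.X ^ k ∣ X - Y) (hj : j < k) (p : K) :
    PowerSeries.coeff j (seriesPow X p) = PowerSeries.coeff j (seriesPow Y p) := by
  rw [coeff_seriesPow, coeff_seriesPow]
  refine Finset.sum_congr rfl (fun n _ => ?_)
  have h' : PowerSeries.X ^ k ∣ (X - 1) - (Y - 1) := by rwa [sub_sub_sub_cancel_right]
  rw [coeff_eq_of_X_pow_dvd_sub (h'.trans (sub_dvd_pow_sub_pow _ _ n)) hj]

-- Every operator comes with a factor `g ^ n`, `n ≥ 1`, so agreement of two arguments below order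
-- `k` gives agreement of the right-hand sides up to order `k` included.
theorem existsUnique_solvesDSE (κ : K) (B : ℕ → HR K D →ₗ[K] HR K D) :
    ∃! X : PowerSeries (HR K D), SolvesDSE κ B X := by
  refine existsUnique_fixedPoint_powerSeries (fun k X Y h => ?_)
  rw [add_sub_add_left_eq_sub, PowerSeries.X_pow_dvd_iff]
  intro j hj
  rw [map_sub, PowerSeries.coeff_mk, PowerSeries.coeff_mk, sub_eq_zero]
  refine Finset.sum_congr rfl (fun n hn => ?_)
  have := Finset.mem_Icc.1 hn
  rw [coeff_seriesPow_congr h (by omega)]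

theorem mapCoeff_eq_map {A : Type u} {B : Type w} [CommRing A] [Algebra K A] [CommRing B]
    [Algebra K B] (f : A →ₐ[K] B) (X : PowerSeries A) :
    mapCoeff f.toLinearMap X = PowerSeries.map (f : A →+* B) X := by
  ext n
  rw [mapCoeff, PowerSeries.coeff_mk, PowerSeries.coeff_map]
  rfl

theorem map_seriesPow {A : Type u} {B : Type w} [CommRing A] [Algebra K A] [CommRing B]
    [Algebra K B] (f : A →ₐ[K] B) (X : PowerSeries A) (p : K) :
    PowerSeries.map (f : A →+* B) (seriesPow X p)
      = seriesPow (PowerSeries.map (f : A →+* B) X) p := by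
  ext k
  rw [PowerSeries.coeff_map, coeff_seriesPow, coeff_seriesPow, map_sum]
  refine Finset.sum_congr rfl (fun n _ => ?_)
  rw [← map_one (PowerSeries.map (f : A →+* B)), ← map_sub, ← map_pow, PowerSeries.coeff_map,
    RingHom.coe_coe, map_smul]

theorem SolvesDSE.coeff_eq {κ : K} {B : ℕ → HR K D →ₗ[K] HR K D} {X : PowerSeries (HR K D)}
    (h : SolvesDSE κ B X) (k : ℕ) :
    PowerSeries.coeff k X = PowerSeries.coeff k 1 + ∑ n ∈ Finset.Icc 1 k,
      B n (PowerSeries.coeff (k - n) (seriesPow X (1 + (n : K) * κ))) := by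
  conv_lhs => rw [h]
  rw [map_add, PowerSeries.coeff_mk]

/-- The powers are built from ring operations and scalars of `K`, so an algebra morphism passes
through them, and intertwining the operators is all that is needed. -/
theorem SolvesDSE.mapCoeff {κ : K} {B B' : ℕ → HR K D →ₗ[K] HR K D} {X : PowerSeries (HR K D)}
    (h : SolvesDSE κ B X) (f : HR K D →ₐ[K] HR K D) (hf : ∀ n x, f (B n x) = B' n (f x)) :
    SolvesDSE κ B' (mapCoeff f.toLinearMap X) := by
  rw [mapCoeff_eq_map]
  refine PowerSeries.ext (fun k => ?_)
  rw [PowerSeries.coeff_map, h.coeff_eq, map_add, map_sum, ← PowerSeries.coeff_map, map_one,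
    map_add, PowerSeries.coeff_mk]
  congr 1
  refine Finset.sum_congr rfl (fun n _ => ?_)
  rw [← map_seriesPow, PowerSeries.coeff_map]
  exact hf n _

end Equations

/-! ### The filtration by number of nodes -/

section Filtration

variable {K : Type v} [Field K] {D : Type u}

theorem forest_mem_HRle {w : Forest D} {m : ℕ} (h : w.size ≤ m) : forest K w ∈ HRle K m :=
  Submodule.subset_span ⟨w, h, rfl⟩

theorem HRle_mono {m n : ℕ} (h : m ≤ n) : (HRle K m : Submodule K (HR K D)) ≤ HRle K n :=
  Submodule.span_mono (fun _ ⟨w, hw, hx⟩ => ⟨w, hw.trans h, hx⟩)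

theorem one_mem_HRle (m : ℕ) : (1 : HR K D) ∈ HRle K m := by
  have := forest_mem_HRle (K := K) (D := D) (w := 0) (m := m) (by simp [Forest.size])
  simpa [forest] using this

theorem mul_mem_HRle {m n : ℕ} {x y : HR K D} (hx : x ∈ HRle K m) (hy : y ∈ HRle K n) :
    x * y ∈ HRle K (m + n) := by
  induction hx using Submodule.span_induction with
  | zero => simp
  | add a b _ _ ha hb => rw [add_mul]; exact add_mem ha hb
  | smul c a _ ha => rw [smul_mul_assoc]; exact Submodule.smul_mem _ c ha
  | mem x hx =>
    obtain ⟨v, hv, rfl⟩ := hx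
    induction hy using Submodule.span_induction with
    | zero => simp
    | add a b _ _ ha hb => rw [mul_add]; exact add_mem ha hb
    | smul c a _ ha => rw [mul_smul_comm]; exact Submodule.smul_mem _ c ha
    | mem y hy =>
      obtain ⟨w, hw, rfl⟩ := hy
      have h : forest K v * forest K w = forest K (v + w) := by simp [forest]
      rw [h]
      refine forest_mem_HRle ?_
      have : (v + w).size = v.size + w.size := by simp [Forest.size]
      omega

theorem graft_mem_HRle (d : D) {m : ℕ} {x : HR K D} (hx : x ∈ HRle K m) :
    graft K d x ∈ HRle K (m + 1) := by
  induction hx using Submodule.span_induction with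
  | zero => simp
  | add a b _ _ ha hb => rw [map_add]; exact add_mem ha hb
  | smul c a _ ha => rw [map_smul]; exact Submodule.smul_mem _ c ha
  | mem x hx =>
    obtain ⟨w, hw, rfl⟩ := hx
    have h : (MvPolynomial.X (Tree.node d w) : HR K D) = forest K {Tree.node d w} := by
      simp [forest]
    rw [graft_forest, h]
    refine forest_mem_HRle ?_
    have : Forest.size {Tree.node d w} = 1 + w.size := by
      rw [Forest.size, Multiset.map_singleton, Multiset.sum_singleton, Tree.size, Tree.fold_node]
      rfl
    omega

/-- The hypothesis is truncated at order `k` because the strong induction on solutions knows only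
the lower coefficients. -/
theorem coeff_pow_mem_HRle {Y : PowerSeries (HR K D)} {k : ℕ}
    (hY : ∀ i ≤ k, PowerSeries.coeff i Y ∈ HRle K i) (n : ℕ) :
    ∀ i ≤ k, PowerSeries.coeff i (Y ^ n) ∈ HRle K i := by
  induction n with
  | zero =>
    intro i _
    rw [pow_zero, PowerSeries.coeff_one]
    split_ifs
    · exact one_mem_HRle i
    · exact zero_mem _
  | succ n ih =>
    intro i hi
    rw [pow_succ, PowerSeries.coeff_mul]
    refine sum_mem (fun ij hij => ?_)
    have hij := Finset.HasAntidiagonal.mem_antidiagonal.1 hij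
    rw [← hij]
    exact mul_mem_HRle (ih _ (by omega)) (hY _ (by omega))

theorem coeff_seriesPow_mem_HRle {X : PowerSeries (HR K D)} {k : ℕ}
    (hX : ∀ i ≤ k, PowerSeries.coeff i X ∈ HRle K i) (p : K) :
    PowerSeries.coeff k (seriesPow X p) ∈ HRle K k := by
  rw [coeff_seriesPow]
  refine sum_mem (fun n _ => Submodule.smul_mem _ _ (coeff_pow_mem_HRle (fun i hi => ?_) n k le_rfl))
  rw [map_sub]
  exact sub_mem (hX i hi) (by simpa using coeff_pow_mem_HRle hX 0 i hi)

theorem SolvesDSE.coeff_mem_HRle {κ : K} {B : ℕ → HR K D →ₗ[K] HR K D}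
    (hB : ∀ n m x, x ∈ HRle K m → B n x ∈ HRle K (m + 1)) {X : PowerSeries (HR K D)}
    (h : SolvesDSE κ B X) (k : ℕ) : PowerSeries.coeff k X ∈ HRle K k := by
  induction k using Nat.strong_induction_on with
  | _ k ih =>
    rw [h.coeff_eq]
    refine add_mem ?_ (sum_mem (fun n hn => ?_))
    · rw [PowerSeries.coeff_one]
      split_ifs
      · exact one_mem_HRle k
      · exact zero_mem _
    · have hn := Finset.mem_Icc.1 hn
      -- One grafting adds one node while the order in `g` grows by `n ≥ 1`, so `k - n + 1 ≤ k`.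
      exact HRle_mono (by omega) (hB n (k - n) _
        (coeff_seriesPow_mem_HRle (fun i hi => ih i (by omega)) _))

end Filtration

/-! ### Change of coefficients in Laurent series -/

section LaurentMaps

variable {R : Type v} {S : Type w} [CommRing R] [CommRing S]

/-- A ring homomorphism applied to the coefficients of a Laurent series. -/
noncomputable def laurentMap (f : R →+* S) : LaurentSeries R →+* LaurentSeries S where
  toFun x := HahnSeries.map x f
  map_one' := by
    ext n
    by_cases h : n = 0 <;> simp [HahnSeries.coeff_one, h]
  map_zero' := by
    ext n
    simp
  map_add' x y := by
    ext n
    simp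
  map_mul' x y := HahnSeries.map_mul (f : R →ₙ+* S)

theorem laurentMap_coeff (f : R →+* S) (x : LaurentSeries R) (n : ℤ) :
    (laurentMap f x).coeff n = f (x.coeff n) := rfl

theorem laurentMap_ofPowerSeries (f : R →+* S) (x : PowerSeries R) :
    laurentMap f (HahnSeries.ofPowerSeries ℤ R x)
      = HahnSeries.ofPowerSeries ℤ S (PowerSeries.map f x) := by
  ext n
  rw [laurentMap_coeff, PowerSeries.coeff_coe, PowerSeries.coeff_coe]
  split_ifs
  · exact map_zero f
  · rw [PowerSeries.coeff_map]

end LaurentMaps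

/-! ### Polynomial operators acting on the coefficients of series in `z` -/

section Coefficientwise

open Polynomial

variable {K : Type v} [Field K]

/-- A linear operator on polynomials applied to the coefficients of a power series. -/
noncomputable def powerSeriesOp (G : K[X] →ₗ[K] K[X]) :
    PowerSeries K[X] →ₗ[K] PowerSeries K[X] where
  toFun f := PowerSeries.mk fun n => G (PowerSeries.coeff n f)
  map_add' f g := by
    ext1 n
    simp
  map_smul' c f := by
    ext1 n
    simp

theorem coeff_powerSeriesOp (G : K[X] →ₗ[K] K[X]) (f : PowerSeries K[X]) (n : ℕ) :
    PowerSeries.coeff n (powerSeriesOp G f) = G (PowerSeries.coeff n f) :=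
  PowerSeries.coeff_mk n fun n => G (PowerSeries.coeff n f)

/-- A linear operator on polynomials applied to the coefficients of a Laurent series. -/
noncomputable def laurentOp (G : K[X] →ₗ[K] K[X]) :
    LaurentSeries K[X] →+ LaurentSeries K[X] where
  toFun f := HahnSeries.map f G
  map_zero' := by
    ext1
    ext1 n
    simp
  map_add' f g := by
    ext1
    ext1 n
    simp

theorem coeff_laurentOp (G : K[X] →ₗ[K] K[X]) (f : LaurentSeries K[X]) (n : ℤ) :
    (laurentOp G f).coeff n = G (f.coeff n) := rfl

theorem laurentOp_ofPowerSeries (G : K[X] →ₗ[K] K[X]) (f : PowerSeries K[X]) :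
    laurentOp G (HahnSeries.ofPowerSeries ℤ K[X] f)
      = HahnSeries.ofPowerSeries ℤ K[X] (powerSeriesOp G f) := by
  refine HahnSeries.ext (funext (fun n => ?_))
  rw [coeff_laurentOp, PowerSeries.coeff_coe, PowerSeries.coeff_coe]
  split_ifs
  · exact map_zero G
  · rw [coeff_powerSeriesOp]

/-- Operators applied coefficientwise are linear over the series with constant coefficients. -/
theorem laurentOp_laurentMap_mul (G : K[X] →ₗ[K] K[X]) (c : LaurentSeries K)
    (f : LaurentSeries K[X]) :
    laurentOp G (laurentMap C c * f) = laurentMap C c * laurentOp G f := by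
  refine HahnSeries.ext (funext (fun n => ?_))
  have hs : (laurentOp G f).support ⊆ f.support := by
    intro m hm h
    rw [HahnSeries.mem_support, coeff_laurentOp] at hm
    exact hm (by rw [h, map_zero])
  -- The operator may kill coefficients and shrink the support. Summing both products over the
  -- support of `f` makes the index sets agree.
  rw [coeff_laurentOp, HahnSeries.coeff_mul_right' f.isPWO_support hs, HahnSeries.coeff_mul,
    map_sum]
  refine Finset.sum_congr rfl (fun ij _ => ?_)
  rw [laurentMap_coeff, C_mul', map_smul, C_mul', coeff_laurentOp]

end Coefficientwise

/-! ### The action of `∫₀ + δη` on exponentials -/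

section Exponentials

open Polynomial

variable {K : Type v} [Field K]

variable (K) in
/-- The series `exp (- m x z)` in `z`, with coefficients the polynomials in `x`. -/
noncomputable def expXZ (m : K) : PowerSeries K[X] :=
  PowerSeries.mk fun n => (-m) ^ n • dpow K n

theorem constantCoeff_expXZ (m : K) : PowerSeries.constantCoeff (expXZ K m) = 1 := by
  rw [← PowerSeries.coeff_zero_eq_constantCoeff_apply, expXZ, PowerSeries.coeff_mk, dpow_zero]
  simp

variable [CharZero K]

theorem expXZ_eq_rescale (m : K) :
    expXZ K m = PowerSeries.rescale (C (-m) * X) (PowerSeries.exp K[X]) := by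
  refine PowerSeries.ext (fun n => ?_)
  rw [expXZ, PowerSeries.coeff_mk, PowerSeries.coeff_rescale, PowerSeries.coeff_exp, dpow,
    ← smul_X_eq_monomial, mul_pow, ← C_pow, IsScalarTower.algebraMap_apply ℚ K K[X],
    ← C_eq_algebraMap, smul_eq_C_mul, smul_eq_C_mul]
  simp
  ring

theorem expXZ_pow (n : ℕ) : expXZ K 1 ^ n = expXZ K (n : K) := by
  rw [expXZ_eq_rescale, expXZ_eq_rescale, ← map_pow, PowerSeries.exp_pow_eq_rescale_exp,
    PowerSeries.rescale_rescale]
  congr 2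
  simp

theorem map_eval_expXZ (m c : K) :
    PowerSeries.map (evalRingHom c) (expXZ K m)
      = PowerSeries.rescale (-(m * c)) (PowerSeries.exp K) := by
  refine PowerSeries.ext (fun n => ?_)
  rw [PowerSeries.coeff_map, expXZ, PowerSeries.coeff_mk, PowerSeries.coeff_rescale,
    PowerSeries.coeff_exp, dpow, coe_evalRingHom, eval_smul, eval_monomial, ← neg_mul, mul_pow]
  simp
  ring

/-- The operator `∫₀ + δη` on polynomials. -/
noncomputable def physicalOp (F : LaurentSeries K) : K[X] →ₗ[K] K[X] :=
  polyInt + polyCoboundary (eta F)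

/-- `∫₀ + δη` acts on the exponential `exp (- m x z)` as subtraction at `x = 0` after
multiplication by `F (m z)`. -/
theorem laurentOp_expXZ {F : LaurentSeries K} (hpole : ∀ n : ℤ, n < -1 → F.coeff n = 0)
    (hres : F.coeff (-1) = -1) {m : K} (hm : m ≠ 0) :
    laurentOp (physicalOp F) (HahnSeries.ofPowerSeries ℤ K[X] (expXZ K m))
      = laurentMap C (dilate m F) * (HahnSeries.ofPowerSeries ℤ K[X] (expXZ K m) - 1) := by
  -- The pole part and the regular part of `F(mz)` are separated: the former will match `∫₀`, the
  -- latter `δη`.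
  have hF : dilate m F = HahnSeries.single (-1) (-m⁻¹)
      + HahnSeries.ofPowerSeries ℤ K (PowerSeries.mk fun n : ℕ => m ^ n * F.coeff n) := by
    refine HahnSeries.ext (funext (fun n => ?_))
    rw [HahnSeries.coeff_add, PowerSeries.coeff_coe]
    change m ^ n * F.coeff n = _
    rcases lt_trichotomy n (-1) with h | rfl | h
    · rw [hpole n h, HahnSeries.coeff_single_of_ne h.ne, if_pos (by omega)]
      simp
    · rw [hres, HahnSeries.coeff_single_same, if_pos (by omega)]
      simp
    · obtain ⟨k, rfl⟩ := Int.eq_ofNat_of_zero_le (show 0 ≤ n by omega)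
      rw [HahnSeries.coeff_single_of_ne h.ne', if_neg (by omega), PowerSeries.coeff_mk]
      simp
  -- The subtraction makes the exponential divisible by `z`, which cancels the simple pole.
  have hE : expXZ K m - 1 = PowerSeries.X
      * PowerSeries.mk fun n => (-m) ^ (n + 1) • dpow K (n + 1) := by
    refine PowerSeries.ext (fun n => ?_)
    rw [mul_comm]
    cases n with
    | zero => simp [constantCoeff_expXZ]
    | succ n =>
      rw [PowerSeries.coeff_succ_mul_X, map_sub, expXZ, PowerSeries.coeff_mk, PowerSeries.coeff_mk,
        PowerSeries.coeff_one, if_neg (Nat.succ_ne_zero n), sub_zero]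
  have hS : laurentMap C (HahnSeries.single (-1) (-m⁻¹) : LaurentSeries K)
      = HahnSeries.C (C (-m⁻¹)) * HahnSeries.single (-1) 1 := by
    refine HahnSeries.ext (funext (fun n => ?_))
    rw [laurentMap_coeff, HahnSeries.C_mul_eq_smul, HahnSeries.coeff_smul,
      HahnSeries.coeff_single, HahnSeries.coeff_single]
    split_ifs <;> simp
  rw [hF, map_add, add_mul, hS, ← map_one (HahnSeries.ofPowerSeries ℤ K[X]), ← map_sub,
    laurentMap_ofPowerSeries, ← map_mul]
  -- Only the factor next to the pole is divided by `z`; the one next to the regular part stays as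
  -- it is.
  nth_rw 1 [hE]
  rw [map_mul, HahnSeries.ofPowerSeries_X, mul_assoc, ← mul_assoc (HahnSeries.single (-1) 1),
    HahnSeries.single_mul_single, neg_add_cancel, one_mul]
  change _ = _ * (1 * _) + _
  rw [one_mul, ← HahnSeries.ofPowerSeries_C, ← map_mul, ← map_add, laurentOp_ofPowerSeries]
  congr 1
  refine PowerSeries.ext (fun n => ?_)
  rw [coeff_powerSeriesOp, map_add, PowerSeries.coeff_C_mul, PowerSeries.coeff_mk, mul_sub,
    mul_one, map_sub, mul_comm (PowerSeries.map C _), PowerSeries.coeff_mul, PowerSeries.coeff_map,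
    PowerSeries.coeff_mk, expXZ, PowerSeries.coeff_mk, map_smul, physicalOp, LinearMap.add_apply,
    polyInt_dpow, polyCoboundary_dpow, smul_add, smul_sub, Finset.smul_sum]
  congr 1
  -- The pole term: `(-m) ^ n = -m⁻¹ (-m) ^ (n + 1)`.
  · rw [C_mul', smul_smul, pow_succ]
    congr 1
    field_simp
  congr 1
  · refine Finset.sum_congr rfl (fun ij hij => ?_)
    have hij := Finset.HasAntidiagonal.mem_antidiagonal.1 hij
    rw [PowerSeries.coeff_map, PowerSeries.coeff_mk, PowerSeries.coeff_mk, mul_comm _ (C _), C_mul',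
      smul_smul, smul_smul, eta_dpow, ← hij, pow_add, neg_pow m ij.2]
    congr 1
    -- One sign comes from the definition of `η`, the other from the exponential `exp(-mxz)`.
    have : ((-1 : K) ^ ij.2) * (-1) ^ ij.2 = 1 := by rw [← mul_pow]; simp
    linear_combination ((-m) ^ ij.1 * m ^ ij.2 * F.coeff ij.2) * this
  · rw [smul_C, eta_dpow, neg_pow m]
    congr 1
    have : ((-1 : K) ^ n) * (-1) ^ n = 1 := by rw [← mul_pow]; simp
    rw [smul_eq_mul]
    linear_combination (m ^ n * F.coeff n) * this

end Exponentials

/-! ### Kinetic subtraction as a recursion on polynomials in `S` -/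

section Subtraction

open Polynomial

variable {K : Type v} [Field K]

theorem mellinOp_monomial (F : LaurentSeries K) (n : ℕ) (c : LaurentSeries K) :
    mellinOp F (monomial n c) = monomial (n + 1) (dilate ((n : K) + 1) F * c) := by
  simp only [mellinOp, lsum_apply]
  rw [sum_monomial_index _ _ (by simp)]
  rfl

/-- Needed because the counterterm factor of the convolution is a Laurent series constant in `S`. -/
theorem mellinOp_C_mul (F u : LaurentSeries K) (p : (LaurentSeries K)[X]) :
    mellinOp F (C u * p) = C u * mellinOp F p := by
  induction p using Polynomial.induction_on' with
  | add p q hp hq => rw [mul_add, map_add, hp, hq, map_add, mul_add]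
  | monomial n c =>
    rw [C_mul_monomial, mellinOp_monomial, mellinOp_monomial, C_mul_monomial, mul_left_comm]

variable [CharZero K] {D : Type u}

/-- The value `exp (- a z)` of `S` at `log s = a`. -/
noncomputable def expAt (a : K) : LaurentSeries K :=
  HahnSeries.ofPowerSeries ℤ K (PowerSeries.rescale (-a) (PowerSeries.exp K))

theorem regRulesAt_apply (F : D → LaurentSeries K) (a : K) (x : HR K D) :
    regRulesAt F a x = aeval (expAt a) (regRules F x) := rfl

/-- The Feynman rules subtracted at `log μ = b`, as functions of `S`. -/
noncomputable def subtractedRules (F : D → LaurentSeries K) (b : K) :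
    HR K D →ₐ[K] (LaurentSeries K)[X] :=
  (Algebra.TensorProduct.lmul' K).comp ((Algebra.TensorProduct.map
    ((CAlgHom (R := K) (A := LaurentSeries K)).comp ((regRulesAt F b).comp (antipode K D)))
    (regRules F)).comp (comul K D))

theorem aeval_subtractedRules (F : D → LaurentSeries K) (a b : K) (x : HR K D) :
    aeval (expAt a) (subtractedRules F b x) = renRules F a b x := by
  rw [subtractedRules, AlgHom.comp_apply, AlgHom.comp_apply, renRules, conv]
  simp only [LinearMap.comp_apply, AlgHom.toLinearMap_apply]
  induction comul K D x with
  | zero => simp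
  | add y z hy hz => simp only [map_add, hy, hz]
  | tmul y z =>
    rw [Algebra.TensorProduct.map_tmul, Algebra.TensorProduct.lmul'_apply_tmul, map_mul,
      TensorProduct.map_tmul, LinearMap.mul'_apply, ← regRulesAt_apply, AlgHom.comp_apply,
      CAlgHom_apply, aeval_C]
    rfl

/-- At equal scales the convolution is the character at `b` applied to `antipode ⋆ id`, that is to
the counit, which vanishes on grafted elements. -/
theorem renRules_self_graft (F : D → LaurentSeries K) (b : K) (d : D) (x : HR K D) :
    renRules F b b (graft K d x) = 0 := by
  have h : ∀ y, renRules F b b y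
      = regRulesAt F b (conv (antipode K D).toLinearMap LinearMap.id y) := by
    intro y
    rw [renRules, conv, conv]
    simp only [LinearMap.comp_apply, AlgHom.toLinearMap_apply]
    induction comul K D y with
    | zero => simp
    | add y z hy hz => simp only [map_add, hy, hz]
    | tmul y z => simp
  rw [h, antipode_conv_id, LinearMap.comp_apply, AlgHom.toLinearMap_apply, counit_graft, map_zero,
    map_zero]

theorem subtractedRules_graft (F : D → LaurentSeries K) (b : K) (d : D) (x : HR K D) :
    subtractedRules F b (graft K d x) = mellinOp (F d) (subtractedRules F b x)
      - C (aeval (expAt b) (mellinOp (F d) (subtractedRules F b x))) := by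
  have h : subtractedRules F b (graft K d x)
      = C (regRulesAt F b (antipode K D (graft K d x)))
        + mellinOp (F d) (subtractedRules F b x) := by
    simp only [subtractedRules, AlgHom.comp_apply]
    rw [comul_graft, map_add, map_add, Algebra.TensorProduct.map_tmul,
      Algebra.TensorProduct.lmul'_apply_tmul, map_one, mul_one]
    congr 1
    induction comul K D x with
    | zero => simp
    | add y z hy hz => simp only [map_add, hy, hz]
    | tmul y z =>
      rw [LinearMap.lTensor_tmul, Algebra.TensorProduct.map_tmul, Algebra.TensorProduct.map_tmul,
        Algebra.TensorProduct.lmul'_apply_tmul, Algebra.TensorProduct.lmul'_apply_tmul, regRules,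
        univ_graft]
      exact (mellinOp_C_mul _ _ _).symm
  -- The counterterm need not be computed: being constant in `S`, it is fixed by the vanishing of
  -- the renormalized rules at `S = exp(-bz)`.
  have h₀ := aeval_subtractedRules F b b (graft K d x)
  rw [renRules_self_graft, h, map_add, aeval_C] at h₀
  have h₁ : regRulesAt F b (antipode K D (graft K d x))
      = -aeval (expAt b) (mellinOp (F d) (subtractedRules F b x)) :=
    eq_neg_of_add_eq_zero_left h₀
  rw [h, h₁, map_neg]
  ring

end Subtraction

/-! ### Absence of poles and the value at `z = 0` -/

section PhysicalLimit

open Polynomial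

variable {K : Type v} [Field K] [CharZero K] {D : Type u}

/-- The series `exp (- (x + b) z)` in `z`, with coefficients the polynomials in `x`. -/
noncomputable def expS (b : K) : PowerSeries K[X] :=
  expXZ K 1 * PowerSeries.map C (PowerSeries.rescale (-b) (PowerSeries.exp K))

theorem constantCoeff_expS (b : K) : PowerSeries.constantCoeff (expS b) = 1 := by
  rw [expS, map_mul, constantCoeff_expXZ, one_mul,
    ← PowerSeries.coeff_zero_eq_constantCoeff_apply, PowerSeries.coeff_map,
    PowerSeries.coeff_rescale]
  simp

theorem map_eval_expS (a b : K) :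
    PowerSeries.map (evalRingHom (a - b)) (expS b)
      = PowerSeries.rescale (-a) (PowerSeries.exp K) := by
  have h : (PowerSeries.map (evalRingHom (a - b))) ((PowerSeries.map C)
      (PowerSeries.rescale (-b) (PowerSeries.exp K)))
        = PowerSeries.rescale (-b) (PowerSeries.exp K) :=
    PowerSeries.ext (fun n => by
      rw [PowerSeries.coeff_map, PowerSeries.coeff_map, coe_evalRingHom, eval_C])
  rw [expS, map_mul, map_eval_expXZ, h, PowerSeries.exp_mul_exp_eq_exp_add]
  congr 2
  ring

/-- Splits `exp(-n(x+b)z)` into a factor free of `x`, over which coefficientwise operators are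
linear, and the exponential handled by `laurentOp_expXZ`. -/
theorem ofPowerSeries_expS_pow (b : K) (n : ℕ) :
    HahnSeries.ofPowerSeries ℤ K[X] (expS b) ^ n
      = laurentMap C (expAt b) ^ n * HahnSeries.ofPowerSeries ℤ K[X] (expXZ K (n : K)) := by
  rw [expS, map_mul, mul_pow, ← map_pow, expXZ_pow, expAt, laurentMap_ofPowerSeries, mul_comm]

/-- The substitution `S = exp (- (x + b) z)`. -/
noncomputable def substExp (b : K) : (LaurentSeries K)[X] →+* LaurentSeries K[X] :=
  eval₂RingHom (laurentMap C) (HahnSeries.ofPowerSeries ℤ K[X] (expS b))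

theorem substExp_monomial (b : K) (n : ℕ) (c : LaurentSeries K) :
    substExp b (monomial n c)
      = laurentMap C c * HahnSeries.ofPowerSeries ℤ K[X] (expS b) ^ n := by
  rw [substExp, coe_eval₂RingHom, eval₂_monomial]

theorem substExp_C (b : K) (c : LaurentSeries K) : substExp b (C c) = laurentMap C c := by
  rw [substExp, coe_eval₂RingHom, eval₂_C]

/-- At `x = a - b` the substituted exponential is `exp(-az)`, so one series over `K[x]` encodes all
scales `a` at once. -/
theorem laurentMap_eval_substExp (a b : K) (p : (LaurentSeries K)[X]) :
    laurentMap (evalRingHom (a - b)) (substExp b p) = aeval (expAt a) p := by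
  have h : (laurentMap (evalRingHom (a - b))).comp (substExp b)
      = (aeval (R := LaurentSeries K) (expAt a) : (LaurentSeries K)[X] →+* LaurentSeries K) := by
    refine Polynomial.ringHom_ext (fun c => ?_) ?_
    · rw [RingHom.comp_apply, substExp_C, RingHom.coe_coe, aeval_C]
      refine HahnSeries.ext (funext (fun n => ?_))
      rw [laurentMap_coeff, laurentMap_coeff, coe_evalRingHom, eval_C]
      rfl
    · rw [RingHom.comp_apply, substExp, coe_eval₂RingHom, eval₂_X, RingHom.coe_coe, aeval_X,
        laurentMap_ofPowerSeries, map_eval_expS, expAt]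
  exact RingHom.congr_fun h p

/-- Under the substitution, the subtracted integral operator becomes `∫₀ + δη` applied
coefficientwise, after multiplication by `S`. -/
theorem substExp_mellinOp {F : LaurentSeries K} (hpole : ∀ n : ℤ, n < -1 → F.coeff n = 0)
    (hres : F.coeff (-1) = -1) (b : K) (p : (LaurentSeries K)[X]) :
    substExp b (mellinOp F p - C (aeval (expAt b) (mellinOp F p)))
      = laurentOp (physicalOp F) (HahnSeries.ofPowerSeries ℤ K[X] (expS b) * substExp b p) := by
  induction p using Polynomial.induction_on' with
  | add p q hp hq =>
    rw [map_add (substExp b), mul_add, map_add (laurentOp _), ← hp, ← hq, ← map_add, map_add,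
      map_add, map_add]
    congr 1
    ring
  | monomial n c =>
    have hn : (n : K) + 1 ≠ 0 := Nat.cast_add_one_ne_zero n
    have h := laurentOp_expXZ hpole hres hn
    rw [mellinOp_monomial, map_sub, substExp_monomial, substExp_C, aeval_monomial,
      Algebra.algebraMap_self, RingHom.id_apply, substExp_monomial, mul_left_comm, ← pow_succ',
      ofPowerSeries_expS_pow, ← map_pow,
      laurentOp_laurentMap_mul, laurentOp_laurentMap_mul]
    -- The exponential formula applies with `m = n + 1`, and subtraction at `x = 0` coincides with
    -- subtraction at `S = exp(-bz)`.
    rw [Nat.cast_succ, h, map_mul, map_mul, map_mul]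
    ring

/-- The subtracted rules after the substitution, as power series without poles. -/
noncomputable def physicalSeries (F : D → LaurentSeries K) (b : K) :
    HR K D →ₐ[K] PowerSeries K[X] :=
  univ fun d => powerSeriesOp (physicalOp (F d)) ∘ₗ LinearMap.mulLeft K (expS b)

theorem physicalSeries_graft (F : D → LaurentSeries K) (b : K) (d : D) (x : HR K D) :
    physicalSeries F b (graft K d x)
      = powerSeriesOp (physicalOp (F d)) (expS b * physicalSeries F b x) := univ_graft _ d x

theorem physicalSeries_C (F : D → LaurentSeries K) (b c : K) :
    physicalSeries F b (MvPolynomial.C c) = PowerSeries.C (C c) :=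
  ((physicalSeries F b).commutes c).trans PowerSeries.algebraMap_apply

theorem constantCoeff_physicalSeries (F : D → LaurentSeries K) (b : K) (x : HR K D) :
    PowerSeries.constantCoeff (physicalSeries F b x) = physicalRules F x := by
  have h : (PowerSeries.constantCoeff (R := K[X])).comp
      (physicalSeries F b : HR K D →+* PowerSeries K[X])
        = (physicalRules F : HR K D →+* K[X]) := by
    refine ringHom_ext_graft (fun c => ?_) (fun d x hx => ?_)
    · rw [RingHom.comp_apply, RingHom.coe_coe, RingHom.coe_coe, physicalSeries_C,
        PowerSeries.constantCoeff_C]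
      exact ((physicalRules F).commutes c).symm
    · rw [RingHom.comp_apply, RingHom.coe_coe, RingHom.coe_coe] at hx ⊢
      rw [physicalSeries_graft, physicalRules_graft,
        ← PowerSeries.coeff_zero_eq_constantCoeff_apply, coeff_powerSeriesOp,
        PowerSeries.coeff_zero_eq_constantCoeff_apply, map_mul, constantCoeff_expS, one_mul, hx]
      rfl
  exact RingHom.congr_fun h x

/-- The absence of poles: both sides obey the same recursion under grafting, and the right-hand one
never leaves the power series. -/
theorem substExp_subtractedRules {F : D → LaurentSeries K}
    (hpole : ∀ d, ∀ n : ℤ, n < -1 → (F d).coeff n = 0) (hres : ∀ d, (F d).coeff (-1) = -1)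
    (b : K) (x : HR K D) :
    substExp b (subtractedRules F b x)
      = HahnSeries.ofPowerSeries ℤ K[X] (physicalSeries F b x) := by
  have h : (substExp b).comp (subtractedRules F b : HR K D →+* (LaurentSeries K)[X])
      = (HahnSeries.ofPowerSeries ℤ K[X]).comp
          (physicalSeries F b : HR K D →+* PowerSeries K[X]) := by
    refine ringHom_ext_graft (fun c => ?_) (fun d x hx => ?_)
    · have hc : subtractedRules F b (MvPolynomial.C c) = C (HahnSeries.C c) :=
        (subtractedRules F b).commutes c
      rw [RingHom.comp_apply, RingHom.comp_apply, RingHom.coe_coe, RingHom.coe_coe,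
        physicalSeries_C, hc, substExp_C, HahnSeries.ofPowerSeries_C]
      exact HahnSeries.map_C c C
    · rw [RingHom.comp_apply, RingHom.comp_apply, RingHom.coe_coe, RingHom.coe_coe] at hx ⊢
      rw [physicalSeries_graft, subtractedRules_graft, substExp_mellinOp (hpole d) (hres d), hx,
        ← map_mul, laurentOp_ofPowerSeries]
  exact RingHom.congr_fun h x

theorem isPhysicalLimit_physicalRules {F : D → LaurentSeries K}
    (hpole : ∀ d, ∀ n : ℤ, n < -1 → (F d).coeff n = 0) (hres : ∀ d, (F d).coeff (-1) = -1) :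
    IsPhysicalLimit F (physicalRules F).toLinearMap := by
  intro a b x
  have h : renRules F a b x = HahnSeries.ofPowerSeries ℤ K
      (PowerSeries.map (evalRingHom (a - b)) (physicalSeries F b x)) := by
    rw [← aeval_subtractedRules, ← laurentMap_eval_substExp a b,
      substExp_subtractedRules hpole hres, laurentMap_ofPowerSeries]
  rw [h]
  refine ⟨fun n hn => ?_, ?_⟩
  · rw [PowerSeries.coeff_coe, if_pos hn]
  · rw [PowerSeries.coeff_coe, if_neg (lt_irrefl 0), Int.natAbs_zero, PowerSeries.coeff_map,
      PowerSeries.coeff_zero_eq_constantCoeff_apply, constantCoeff_physicalSeries]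
    rfl

/-- The limits agree as functions on `K`, already with `b = 0`, and `K` is infinite in
characteristic zero. -/
theorem IsPhysicalLimit.unique {F : D → LaurentSeries K} {Φ Φ' : HR K D →ₗ[K] K[X]}
    (h : IsPhysicalLimit F Φ) (h' : IsPhysicalLimit F Φ') : Φ = Φ' := by
  have : Infinite K := Infinite.of_injective (Nat.cast : ℕ → K) Nat.cast_injective
  refine LinearMap.ext (fun x => Polynomial.funext (fun c => ?_))
  have h₁ := (h c 0 x).2
  rw [(h' c 0 x).2, sub_zero] at h₁
  exact h₁.symm

theorem physicalRules_single :
    physicalRules (fun _ : D => HahnSeries.single (-1 : ℤ) (-1 : K)) = leadingLogRules K D := by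
  refine (univ_unique (fun d x => ?_)).symm
  -- The functional sees only coefficients of nonnegative order, and `-1/z` has none.
  have h : eta (HahnSeries.single (-1 : ℤ) (-1 : K)) = 0 := linearMap_ext_dpow (fun n => by
    rw [eta_dpow, HahnSeries.coeff_single_of_ne (by omega)]
    simp)
  rw [leadingLogRules_graft, h, LinearMap.add_apply, polyCoboundary_apply]
  simp

theorem isPhysicalLimit_leadingLogRules :
    IsPhysicalLimit (fun _ : D => HahnSeries.single (-1 : ℤ) (-1 : K))
      (leadingLogRules K D).toLinearMap := by
  rw [← physicalRules_single]
  exact isPhysicalLimit_physicalRules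
    (fun _ n hn => HahnSeries.coeff_single_of_ne hn.ne) (fun _ => HahnSeries.coeff_single_same _ _)

end PhysicalLimit

end DSE

/-- Changing the Mellin transform amounts to applying an automorphism to the perturbation
series. -/
theorem mainTheorem11
    {K : Type*} [Field K] [CharZero K] {D : Type*}
    (F : D → LaurentSeries K)
    (hpole : ∀ d, ∀ n : ℤ, n < -1 → (F d).coeff n = 0)
    (hres : ∀ d, (F d).coeff (-1) = -1)
    (κ : K) (a : ℕ → D →₀ K)
    (B : ℕ → DSE.HR K D →ₗ[K] DSE.HR K D)
    (hB : ∀ n, B n = (a n).sum fun d c => c • DSE.graft K d)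
    (η : ℕ → DSE.HR K D →ₗ[K] K)
    (hη : ∀ n, η n = (a n).sum fun d c => c • DSE.etaTree F d) :
    (∃! Φ : DSE.HR K D →ₗ[K] Polynomial K, DSE.IsPhysicalLimit F Φ) ∧
    -- the original (leading-log) rules belong to the Mellin transform `-1/z`
    DSE.IsPhysicalLimit (fun _ : D => HahnSeries.single (-1 : ℤ) (-1 : K))
      (DSE.leadingLogRules K D).toLinearMap ∧
    (∃! X : PowerSeries (DSE.HR K D), DSE.SolvesDSE κ B X) ∧
    ∀ (Φ : DSE.HR K D →ₗ[K] Polynomial K) (X X' : PowerSeries (DSE.HR K D)),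
      DSE.IsPhysicalLimit F Φ → DSE.SolvesDSE κ B X →
      X' = DSE.mapCoeff (DSE.mellinAuto F).toLinearMap X →
      -- the new correlation function is the old one of the modified series
      DSE.mapCoeff Φ X = DSE.mapCoeff (DSE.leadingLogRules K D).toLinearMap X' ∧
      -- the modified series solves the equation with cocycles modified by coboundaries
      (∀ n, 1 ≤ n → DSE.IsOneCocycle (B n) ∧ DSE.IsOneCocycle (B n + DSE.coboundary (η n))) ∧
      DSE.SolvesDSE κ (fun n => B n + DSE.coboundary (η n)) X' ∧
      -- the leading logarithms coincide, on forests and in each order of the correlation function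
      (∀ w : DSE.Forest D,
        (Φ (DSE.forest K w) - DSE.leadingLogRules K D (DSE.forest K w)).degree < w.size) ∧
      (∀ n : ℕ, PowerSeries.coeff n X ∈ DSE.HRle K n) ∧
      (∀ n m : ℕ, PowerSeries.coeff n X ∈ DSE.HRle K m →
        (PowerSeries.coeff n (DSE.mapCoeff Φ X)).natDegree ≤ m ∧
        (PowerSeries.coeff n
          (DSE.mapCoeff (DSE.leadingLogRules K D).toLinearMap X)).natDegree ≤ m ∧
        (PowerSeries.coeff n (DSE.mapCoeff Φ X)).coeff m
          = (PowerSeries.coeff n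
              (DSE.mapCoeff (DSE.leadingLogRules K D).toLinearMap X)).coeff m) := by
  have hlim := DSE.isPhysicalLimit_physicalRules hpole hres
  have hcob : ∀ n, DSE.coboundary (η n)
      = (a n).sum fun d c => c • DSE.coboundary (DSE.etaTree F d) := by
    intro n
    rw [hη]
    exact (map_finsuppSum DSE.coboundaryHom (a n) _).trans
      (Finset.sum_congr rfl (fun d _ => map_smul DSE.coboundaryHom _ _))
  have hcocycle : ∀ n, DSE.IsOneCocycle (B n) := fun n => by
    rw [hB]
    exact DSE.IsOneCocycle.sum _ (fun d _ => (DSE.isOneCocycle_graft d).smul _)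
  have hBle : ∀ n m x, x ∈ DSE.HRle K m → B n x ∈ DSE.HRle K (m + 1) := by
    intro n m x hx
    rw [hB, Finsupp.sum, LinearMap.sum_apply]
    exact sum_mem (fun d _ => Submodule.smul_mem _ _ (DSE.graft_mem_HRle d hx))
  -- The intertwining relation for single graftings extends to finite combinations because the
  -- coboundary is linear in the functional.
  have hχ : ∀ n x, DSE.mellinAuto F (B n x)
      = (B n + DSE.coboundary (η n)) (DSE.mellinAuto F x) := by
    intro n x
    rw [hcob, hB, Finsupp.sum, Finsupp.sum, ← Finset.sum_add_distrib, LinearMap.sum_apply,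
      LinearMap.sum_apply, map_sum]
    refine Finset.sum_congr rfl (fun d _ => ?_)
    rw [LinearMap.smul_apply, map_smul, DSE.mellinAuto_graft, smul_add]
    rfl
  refine ⟨⟨_, hlim, fun Φ hΦ => hΦ.unique hlim⟩, DSE.isPhysicalLimit_leadingLogRules,
    DSE.existsUnique_solvesDSE κ B, ?_⟩
  rintro Φ X X' hΦ hX rfl
  obtain rfl := hΦ.unique hlim
  refine ⟨?_, fun n _ => ⟨hcocycle n, (hcocycle n).add (DSE.isOneCocycle_coboundary _)⟩,
    hX.mapCoeff _ hχ, fun w => (DSE.sameLeading_forest F w).degree_sub_lt, hX.coeff_mem_HRle hBle,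
    fun n m h => ?_⟩
  · refine PowerSeries.ext (fun n => ?_)
    simp only [DSE.mapCoeff, PowerSeries.coeff_mk, ← DSE.leadingLogRules_comp_mellinAuto]
    rfl
  · simp only [DSE.mapCoeff, PowerSeries.coeff_mk]
    exact DSE.sameLeading_of_mem_HRle F h
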